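/- Let $\mathbb N=\{1,2,\dots\}$ and $\mathbb N_0=\mathbb N\cup\{0\}$. Let $b_{ij},\tilde b_{ij}$, $i,j\in\mathbb N$, be independent standard real Brownian motions, put $B_{ij}(t)=\frac1{\sqrt2}b_{ij}(t)+\frac{\mathrm i}{\sqrt2}\tilde b_{ij}(t)$, and for $N\in\mathbb N$, $\alpha\in\mathbb N_0$, $t\ge 0$ let $A^N(\alpha,t)=(B_{ij}(t))_{1\le i\le N+\alpha,\,1\le j\le N}$. Let $X^N_1(\alpha,t)\le\dots\le X^N_N(\alpha,t)$ be the ordered eigenvalues of $A^N(\alpha,t)^*A^N(\alpha,t)$. For $x,y\in\mathbb R^k$ write $x\preceq y$ if $x_1\le y_1\le x_2\le y_2\le\dots\le x_k\le y_k$, and let $\mathbb W^k=\{x\in\mathbb R^k: x_1<\dots<x_k\}$. For integers $0\le a<b$ and $x,y\in\mathbb W^k$, let $I_{a,b}(x,y)$ be the set of all $(w^{a+1},\dots,w^{b-1})$ with $w^\ell\in\mathbb W^k$ and $x\preceq w^{a+1}\preceq\dots\preceq w^{b-1}\preceq y$. For $z=(z^a,\dots,z^b)\in\mathbb R^{b-a+1}$,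 let $I_{a,b}(x,y,z)$ be the set of all such tuples of $w^\ell\in\mathbb W^k$ with $(x,z^a)\preceq(w^{a+1},z^{a+1})\preceq\dots\preceq(w^{b-1},z^{b-1})\preceq(y,z^b)$. Let $Z_{a,b}(x,y)$ and $Z_{a,b}(x,y,z)$ be the Lebesgue measures of these sets in $\mathbb R^{k(b-a-1)}$ (a single point of measure $1$ if $b=a+1$). **Lemma.** Fix $N\in\mathbb N$ and $t_0>0$, and write $X_j(\alpha)=X^N_j(\alpha,t_0)$. Then $X=(X_j(\alpha))_{1\le j\le N,\ \alpha\in\mathbb N_0}$ satisfies the exponential Gibbs property. That is, almost surely $0<X_1(\alpha)<\dots<X_N(\alpha)$ for all $\alpha\in\mathbb N_0$, and for all integers $0\le a<b$: 1. For every $1\le k<N$, with $x=(X_1(a),\dots,X_k(a))$, $y=(X_1(b),\dots,X_k(b))$ and $z=(X_{k+1}(a),X_{k+1}(a+1),\dots,X_{k+1}(b))$, one has $Z_{a,b}(x,y,z)>0$ almost surely, and the conditional law of $(X_j(\ell))_{1\le j\le k,\ a<\ell<b}$ given all the remaining variables $X_j(\ell)$, $(j,\ell)\in(\{1,\dots,N\}\times\mathbb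 N_0)\setminus(\{1,\dots,k\}\times\{a+1,\dots,b-1\})$, is almost surely the uniform probability measure (normalized Lebesgue measure) on $I_{a,b}(x,y,z)$. 2. With $x=(X_1(a),\dots,X_N(a))$ and $y=(X_1(b),\dots,X_N(b))$, one has $Z_{a,b}(x,y)>0$ almost surely, and the conditional law of $(X_j(\ell))_{1\le j\le N,\ a<\ell<b}$ given all $X_j(\ell)$ with $1\le j\le N$ and $\ell\in\mathbb N_0\setminus\{a+1,\dots,b-1\}$ is almost surely the uniform probability measure on $I_{a,b}(x,y)$. -/

import Mathlib

open MeasureTheory ProbabilityTheory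
open scoped ENNReal NNReal Matrix

noncomputable section

namespace LaguerreField

/-! ### The Laguerre field -/

/-- `b i j` and `bt i j` are all standard real Brownian motions, and the whole family
(every `b i j` together with every `bt i j`) is independent as a family of processes. Rows and
columns are numbered from `0`. -/
structure IsBrownianArray {Ω : Type*} [MeasurableSpace Ω]
    (b bt : ℕ → ℕ → ℝ≥0 → Ω → ℝ) (P : Measure Ω) : Prop where
  brownian_re : ∀ i j, IsBrownianReal (b i j) P
  brownian_im : ∀ i j, IsBrownianReal (bt i j) P
  indep : iIndepFun (fun (q : (ℕ × ℕ) ⊕ (ℕ × ℕ)) (ω : Ω) (t : ℝ≥0) =>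
    Sum.elim (fun p => b p.1 p.2 t ω) (fun p => bt p.1 p.2 t ω) q) P

/-- The complex Brownian motion `B_{ij}(t) = b_{ij}(t) / √2 + i · bt_{ij}(t) / √2`. -/
def complexBM {Ω : Type*} (b bt : ℕ → ℕ → ℝ≥0 → Ω → ℝ) (i j : ℕ) (t : ℝ≥0) (ω : Ω) : ℂ :=
  ((b i j t ω / √2 : ℝ) : ℂ) + Complex.I * ((bt i j t ω / √2 : ℝ) : ℂ)

/-- The `(N + α) × N` matrix `A^N(α, t) = (B_{ij}(t))`. -/
def matA {Ω : Type*} (b bt : ℕ → ℕ → ℝ≥0 → Ω → ℝ) (N α : ℕ) (t : ℝ≥0) (ω : Ω) :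
    Matrix (Fin (N + α)) (Fin N) ℂ :=
  Matrix.of fun i j => complexBM b bt i j t ω

/-- The eigenvalues of a Hermitian `N × N` matrix, with multiplicity, in nondecreasing order
(Mathlib's `eigenvalues₀` lists them in nonincreasing order). -/
def orderedEigenvalues {N : ℕ} {M : Matrix (Fin N) (Fin N) ℂ} (hM : M.IsHermitian) :
    Fin N → ℝ :=
  fun j => hM.eigenvalues₀ (Fin.cast (Fintype.card_fin N).symm (Fin.rev j))

/-- The Laguerre field: `field b bt N α t ω` is the vector
`X₁^N(α, t) ≤ ⋯ ≤ X_N^N(α, t)` of ordered eigenvalues of `A^N(α, t)ᴴ * A^N(α, t)`. -/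
def field {Ω : Type*} (b bt : ℕ → ℕ → ℝ≥0 → Ω → ℝ) (N α : ℕ) (t : ℝ≥0) (ω : Ω) :
    Fin N → ℝ :=
  orderedEigenvalues (Matrix.isHermitian_conjTranspose_mul_self (matA b bt N α t ω))

/-! ### Interlacing sets -/

/-- The Weyl chamber `x₁ < x₂ < ⋯ < x_k`. -/
def weyl (k : ℕ) : Set (Fin k → ℝ) := {x | StrictMono x}

/-- The Weyl chamber in the positive reals, `0 < x₁ < x₂ < ⋯ < x_k`. -/
def weylPos (k : ℕ) : Set (Fin k → ℝ) := {x | StrictMono x ∧ ∀ i, 0 < x i}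

/-- Weak interlacing `x₁ ≤ y₁ ≤ x₂ ≤ y₂ ≤ ⋯ ≤ x_k ≤ y_k`. -/
def WeakInterlace {k : ℕ} (x y : Fin k → ℝ) : Prop :=
  (∀ i, x i ≤ y i) ∧ ∀ i j : Fin k, (i : ℕ) + 1 = (j : ℕ) → y i ≤ x j

/-- A configuration `w^{a+1}, …, w^{b-1}` of `k`-vectors strictly between levels `a` and `b`.
Its Lebesgue measure is the product measure `volume`; for `b = a + 1` it is a single point, of
measure one. -/
abbrev Config (k a b : ℕ) : Type := Set.Ioo a b → Fin k → ℝ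

/-- The sequence `x, w^{a+1}, …, w^{b-1}, y` as a function of the level `ℓ ∈ {a, …, b}`. -/
def path {k a b : ℕ} (x y : Fin k → ℝ) (w : Config k a b) (ℓ : ℕ) : Fin k → ℝ :=
  if h : ℓ ∈ Set.Ioo a b then w ⟨ℓ, h⟩ else if ℓ ≤ a then x else y

/-- `I_{a,b}(x, y)`: all `w` in the Weyl chamber with `x ⪯ w^{a+1} ⪯ ⋯ ⪯ w^{b-1} ⪯ y`. -/
def interlacingSet {k : ℕ} (a b : ℕ) (x y : Fin k → ℝ) : Set (Config k a b) :=
  {w | (∀ ℓ, w ℓ ∈ weyl k) ∧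
    ∀ ℓ, a ≤ ℓ → ℓ < b → WeakInterlace (path x y w ℓ) (path x y w (ℓ + 1))}

/-- `I_{a,b}(x, y, z)`: all `w` in the Weyl chamber with
`(x, z^a) ⪯ (w^{a+1}, z^{a+1}) ⪯ ⋯ ⪯ (w^{b-1}, z^{b-1}) ⪯ (y, z^b)`.
Only the values of `z` at `a, …, b` are used. -/
def interlacingSetTop {k : ℕ} (a b : ℕ) (x y : Fin k → ℝ) (z : ℕ → ℝ) : Set (Config k a b) :=
  {w | (∀ ℓ, w ℓ ∈ weyl k) ∧
    ∀ ℓ, a ≤ ℓ → ℓ < b →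
      WeakInterlace (Fin.snoc (path x y w ℓ) (z ℓ) : Fin (k + 1) → ℝ)
        (Fin.snoc (path x y w (ℓ + 1)) (z (ℓ + 1)))}

/-- `Z_{a,b}(x, y)`, the Lebesgue measure of `I_{a,b}(x, y)`. -/
def Z {k : ℕ} (a b : ℕ) (x y : Fin k → ℝ) : ℝ≥0∞ := volume (interlacingSet a b x y)

/-- `Z_{a,b}(x, y, z)`, the Lebesgue measure of `I_{a,b}(x, y, z)`. -/
def ZTop {k : ℕ} (a b : ℕ) (x y : Fin k → ℝ) (z : ℕ → ℝ) : ℝ≥0∞ :=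
  volume (interlacingSetTop a b x y z)

/-- The normalized Lebesgue measure on `I_{a,b}(x, y)`. -/
def bridgeLaw {k : ℕ} (a b : ℕ) (x y : Fin k → ℝ) : Measure (Config k a b) :=
  ProbabilityTheory.cond volume (interlacingSet a b x y)

/-- The normalized Lebesgue measure on `I_{a,b}(x, y, z)`. -/
def bridgeLawTop {k : ℕ} (a b : ℕ) (x y : Fin k → ℝ) (z : ℕ → ℝ) : Measure (Config k a b) :=
  ProbabilityTheory.cond volume (interlacingSetTop a b x y z)

/-! ### The exponential Gibbs property -/

/-- The lowest `k` coordinates of an `N`-vector. -/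
def lowest {N : ℕ} (k : ℕ) (hk : k ≤ N) (x : Fin N → ℝ) : Fin k → ℝ :=
  fun j => x (Fin.castLE hk j)

/-- The restriction of `X` to the window `{1, …, k} × {a+1, …, b-1}`. -/
def inside {Ω : Type*} {N : ℕ} (X : ℕ → Ω → Fin N → ℝ) (k : ℕ) (hk : k ≤ N) (a b : ℕ)
    (ω : Ω) : Config k a b :=
  fun ℓ => lowest k hk (X ℓ ω)

/-- The complement of the window `{1, …, k} × {a+1, …, b-1}` in `{1, …, N} × ℕ₀`. -/
abbrev OutsideIndex (N k a b : ℕ) : Type :=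
  {p : Fin N × ℕ // ¬ ((p.1 : ℕ) < k ∧ p.2 ∈ Set.Ioo a b)}

/-- The restriction of `X` to the complement of the window. -/
def outside {Ω : Type*} {N : ℕ} (X : ℕ → Ω → Fin N → ℝ) (k a b : ℕ) (ω : Ω) :
    OutsideIndex N k a b → ℝ :=
  fun p => X p.1.2 ω p.1.1

/-- The exponential Gibbs property of a sequence `X(a)`, `a ∈ ℕ₀`, of random vectors with values
in the positive Weyl chamber, for finite `N`. The conditional law of `inside` given `outside` is
the regular conditional distribution `condDistrib`, evaluated at the observed outside values. -/
structure ExponentialGibbs {Ω : Type*} [MeasurableSpace Ω] {N : ℕ} (X : ℕ → Ω → Fin N → ℝ)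
    (P : Measure Ω) [IsProbabilityMeasure P] : Prop where
  aemeasurable : ∀ a, AEMeasurable (X a) P
  mem_weylPos : ∀ᵐ ω ∂P, ∀ a, X a ω ∈ weylPos N
  /-- Windows of the lowest `k < N` particles: the `(k+1)`-st particle (zero-based index `k`)
  is the top boundary. -/
  ZTop_pos : ∀ (k : ℕ) (_ : 1 ≤ k) (hk : k < N) (a b : ℕ), a < b →
    ∀ᵐ ω ∂P, 0 < ZTop a b (lowest k hk.le (X a ω)) (lowest k hk.le (X b ω))
      (fun ℓ => X ℓ ω ⟨k, hk⟩)
  condLaw_top : ∀ (k : ℕ) (_ : 1 ≤ k) (hk : k < N) (a b : ℕ), a < b →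
    ∀ᵐ ω ∂P,
      condDistrib (inside X k hk.le a b) (outside X k a b) P (outside X k a b ω) =
        bridgeLawTop a b (lowest k hk.le (X a ω)) (lowest k hk.le (X b ω))
          (fun ℓ => X ℓ ω ⟨k, hk⟩)
  /-- Windows containing all `N` particles. -/
  Z_pos : ∀ a b : ℕ, a < b → ∀ᵐ ω ∂P, 0 < Z a b (X a ω) (X b ω)
  condLaw : ∀ a b : ℕ, a < b →
    ∀ᵐ ω ∂P,
      condDistrib (inside X N le_rfl a b) (outside X N a b) P (outside X N a b ω) =
        bridgeLaw a b (X a ω) (X b ω)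

end LaguerreField

end

/-! Passing from `α` to `α + 1` appends one independent Gaussian row `a` to the matrix, so the Gram
matrix gains the rank one term `aᴴ a`. The row law is unitarily invariant (`rowLaw_map_unitary`), so
the old Gram matrix may be taken to be `diag(x)` with `x` its ordered spectrum. The new eigenvalues
`y` are then the roots of a secular polynomial whose weights `r i = |v i|²` are independent
exponentials of mean `t`. The map from strictly interlacing `y` to positive weights `r` is a
bijection with Jacobian `Δ(y) / Δ(x)` (`residues_image`, `abs_det_residuesJacobian`), and `∑ r = ∑ y
- ∑ x`. Hence, given the past, `y` has density `t⁻ᴺ g(y) / g(x)` on the vectors interlacing with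
`x`, where `g(x) = Δ(x) exp(-∑ x / t)` (`lintegral_spec_add_rowLaw`).

Along a path the factors `g(y) / g(x)` telescope. Given level `0`, levels `1, …, n` therefore have
density `cⁿ g(s n) / g(s 0)` on interlacing paths (`IsInterlacingChain.lintegral_eq`). A window
strictly between levels `a` and `b ≤ n` touches neither end, so this density is constant in the
window coordinates, and the only constraint left on them is interlacing with their neighbours.
Resampling the window uniformly thus preserves the law (`IsInterlacingChain.lintegral_eq_resample`).
This holds for every finite horizon `n`, hence for the whole sequence, and uniqueness of conditional
distributions gives both Gibbs statements.

Strict ordering and positivity come from level `0`, where a discriminant-type polynomial in the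
Gaussian entries is almost surely nonzero; interlacing carries them upwards. -/

noncomputable section

namespace LaguerreField

open Set Function

variable {N k a b : ℕ}

/-! ### Windows in the space of configurations -/

/-- Replace the window `{1, …, k} × {a+1, …, b-1}` of `s` by `w`. -/
def glue (k a b : ℕ) (s : ℕ → Fin N → ℝ) (w : Config k a b) : ℕ → Fin N → ℝ :=
  fun l j => if h : (j : ℕ) < k ∧ l ∈ Set.Ioo a b then w ⟨l, h.2⟩ ⟨j, h.1⟩ else s l j

/-- Replace the particles above the window `{1, …, k} × {a+1, …, b-1}` by `r`. -/
def glueAbove (k a b : ℕ) (s : ℕ → Fin N → ℝ) (r : Config (N - k) a b) : ℕ → Fin N → ℝ :=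
  fun l j => if h : k ≤ (j : ℕ) ∧ l ∈ Set.Ioo a b then
    r ⟨l, h.2⟩ ⟨j - k, by have := j.2; omega⟩ else s l j

/-- The configuration with prescribed values outside and inside the window. -/
def assemble (o : OutsideIndex N k a b → ℝ) (w : Config k a b) : ℕ → Fin N → ℝ :=
  fun l j => if h : (j : ℕ) < k ∧ l ∈ Set.Ioo a b then w ⟨l, h.2⟩ ⟨j, h.1⟩ else o ⟨(j, l), h⟩

/-- The coordinates outside the window. -/
def offWindow (k a b : ℕ) (s : ℕ → Fin N → ℝ) : OutsideIndex N k a b → ℝ :=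
  fun p => s p.1.2 p.1.1

/-- The coordinates in the window. -/
def onWindow (k : ℕ) (hk : k ≤ N) (a b : ℕ) (s : ℕ → Fin N → ℝ) : Config k a b :=
  fun ℓ => lowest k hk (s ℓ)

lemma measurable_offWindow : Measurable (offWindow (N := N) k a b) := by
  unfold offWindow; fun_prop

lemma measurable_onWindow (hk : k ≤ N) : Measurable (onWindow k hk a b) := by
  unfold onWindow lowest; fun_prop

lemma measurable_assemble :
    Measurable fun p : (OutsideIndex N k a b → ℝ) × Config k a b => assemble p.1 p.2 := by
  refine measurable_pi_iff.2 fun l => measurable_pi_iff.2 fun j => ?_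
  unfold assemble
  split_ifs with h <;> fun_prop

lemma offWindow_assemble (o : OutsideIndex N k a b → ℝ) (w : Config k a b) :
    offWindow k a b (assemble o w) = o := by
  ext ⟨p, hp⟩
  simp only [offWindow, assemble]
  exact dif_neg hp

lemma onWindow_assemble (hk : k ≤ N) (o : OutsideIndex N k a b → ℝ) (w : Config k a b) :
    onWindow k hk a b (assemble o w) = w := by
  ext l j
  have h : ((Fin.castLE hk j : Fin N) : ℕ) < k ∧ (l : ℕ) ∈ Set.Ioo a b := ⟨j.2, l.2⟩
  simp only [onWindow, assemble, lowest, dif_pos h]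
  rfl

lemma glue_eq_assemble (s : ℕ → Fin N → ℝ) (w : Config k a b) :
    glue k a b s w = assemble (offWindow k a b s) w := rfl

/-- Integration over the levels strictly between `a` and `b`, the window of the lowest `k`
particles last. -/
lemma lmarginal_Ioo_eq (hk : k ≤ N) {f : (ℕ → Fin N → ℝ) → ℝ≥0∞} (hf : Measurable f)
    (s : ℕ → Fin N → ℝ) :
    (∫⋯∫⁻_Finset.Ioo a b, f ∂(fun _ => volume)) s =
      ∫⁻ r : Config (N - k) a b, ∫⁻ w : Config k a b, f (glue k a b (glueAbove k a b s r) w) := by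
  let e : ((Fin k → ℝ) × (Fin (N - k) → ℝ)) → (Fin N → ℝ) := fun p j =>
    if h : (j : ℕ) < k then p.1 ⟨j, h⟩ else p.2 ⟨j - k, by have := j.2; omega⟩
  have he : MeasurePreserving e volume volume := by
    let σ : Fin k ⊕ Fin (N - k) ≃ Fin N :=
      finSumFinEquiv.trans (finCongr (by omega))
    have h1 := (volume_measurePreserving_piCongrLeft (fun _ : Fin N => ℝ) σ).comp
      (volume_measurePreserving_sumPiEquivProdPi_symm (fun _ : Fin k ⊕ Fin (N - k) => ℝ))
    convert h1 using 1
    funext p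
    apply (MeasurableEquiv.piCongrLeft (fun _ : Fin N => ℝ) σ).symm.injective
    ext i
    rcases i with i | i
    · simp [e, σ, MeasurableEquiv.piCongrLeft, Equiv.piCongrLeft, MeasurableEquiv.sumPiEquivProdPi]
    · simp [e, σ, MeasurableEquiv.piCongrLeft, Equiv.piCongrLeft, MeasurableEquiv.sumPiEquivProdPi]
  -- At each level `e` joins the lower `k` and upper `N - k` coordinates; exchanging a pair of
  -- families for a family of pairs does so at all levels at once.
  have h2 : MeasurePreserving (fun q : Config k a b × Config (N - k) a b =>
      fun (i : Set.Ioo a b) => e (q.1 i, q.2 i)) volume volume :=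
    (volume_preserving_pi (fun _ : Set.Ioo a b => he)).comp
      (volume_measurePreserving_arrowProdEquivProdArrow
        (Fin k → ℝ) (Fin (N - k) → ℝ) (Set.Ioo a b)).symm
  let τ : Set.Ioo a b ≃ {i // i ∈ Finset.Ioo a b} :=
    Equiv.subtypeEquivRight (fun i => by simp)
  have h3 := (volume_measurePreserving_piCongrLeft
    (fun _ : {i // i ∈ Finset.Ioo a b} => Fin N → ℝ) τ).comp h2
  have h4 : (∫⋯∫⁻_Finset.Ioo a b, f ∂(fun _ => volume)) s =
      ∫⁻ y : ∀ _ : {i // i ∈ Finset.Ioo a b}, Fin N → ℝ,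
        f (updateFinset s (Finset.Ioo a b) y) := rfl
  have hm : Measurable fun y : ∀ _ : {i // i ∈ Finset.Ioo a b}, Fin N → ℝ =>
      f (updateFinset s (Finset.Ioo a b) y) := hf.comp measurable_updateFinset
  rw [h4, ← h3.lintegral_comp hm]
  refine (lintegral_prod_symm _ (hm.comp h3.measurable).aemeasurable).trans ?_
  refine lintegral_congr fun r => lintegral_congr fun w => congrArg f ?_
  ext l j
  by_cases hl : l ∈ Finset.Ioo a b
  · have hl' : l ∈ Set.Ioo a b := by simpa using hl
    have : (MeasurableEquiv.piCongrLeft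
        (fun _ : {i // i ∈ Finset.Ioo a b} => Fin N → ℝ) τ)
          (fun i => e (w i, r i)) ⟨l, hl⟩ = e (w ⟨l, hl'⟩, r ⟨l, hl'⟩) := rfl
    simp only [updateFinset, dif_pos hl, Function.comp_apply, this, glue, glueAbove, e]
    by_cases hj : (j : ℕ) < k
    · simp [hj, hl']
    · simp [hj, hl', not_lt.1 hj]
  · have hl' : l ∉ Set.Ioo a b := by simpa using hl
    simp [updateFinset, hl, glue, glueAbove, hl']

end LaguerreField

end

noncomputable section

namespace LaguerreField

open Set Function

variable {N k a b : ℕ}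

/-! ### Finite-dimensional laws of a chain with an `h`-transform interlacing kernel -/

/-- The sequences whose first `n` steps are interlacing. -/
def chain (N n : ℕ) : Set (ℕ → Fin N → ℝ) := {s | ∀ l < n, WeakInterlace (s l) (s (l + 1))}

lemma measurableSet_weakInterlace {α : Type*} [MeasurableSpace α] {x y : α → Fin N → ℝ}
    (hx : Measurable x) (hy : Measurable y) : MeasurableSet {p | WeakInterlace (x p) (y p)} := by
  unfold WeakInterlace
  refine MeasurableSet.inter (s₁ := {p | ∀ i, x p i ≤ y p i})
    (s₂ := {p | ∀ i j : Fin N, (i : ℕ) + 1 = j → y p i ≤ x p j}) ?_ ?_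
  · simp only [ofPred_forall]
    exact MeasurableSet.iInter fun i => measurableSet_le (by fun_prop) (by fun_prop)
  · simp only [ofPred_forall]
    exact MeasurableSet.iInter fun i => MeasurableSet.iInter fun j =>
      MeasurableSet.iInter fun _ => measurableSet_le (by fun_prop) (by fun_prop)

lemma measurableSet_strictMono {α : Type*} [MeasurableSpace α] {x : α → Fin N → ℝ}
    (hx : Measurable x) : MeasurableSet {p | StrictMono (x p)} := by
  unfold StrictMono
  simp only [ofPred_forall]
  exact MeasurableSet.iInter fun i => MeasurableSet.iInter fun j =>
    MeasurableSet.iInter fun _ => measurableSet_lt (by fun_prop) (by fun_prop)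

lemma measurableSet_chain (n : ℕ) : MeasurableSet (chain N n) := by
  unfold chain
  simp only [ofPred_forall]
  exact MeasurableSet.iInter fun l => MeasurableSet.iInter fun _ =>
    measurableSet_weakInterlace (by fun_prop) (by fun_prop)

/-- The density of the levels `1, …, n` of the chain started at level `0`, without the interlacing
constraint. -/
def levelWeight (c : ℝ≥0∞) (g : (Fin N → ℝ) → ℝ≥0∞) (n : ℕ) (s : ℕ → Fin N → ℝ) : ℝ≥0∞ :=
  c ^ n * g (s n) * (g (s 0))⁻¹

/-- A sequence of random vectors that moves from `x` to `y` with density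
`c g(y) / g(x)` on the set of `y` that interlace with `x`. -/
structure IsInterlacingChain {Ω : Type*} [MeasurableSpace Ω] (X : ℕ → Ω → Fin N → ℝ)
    (P : Measure Ω) (c : ℝ≥0∞) (g : (Fin N → ℝ) → ℝ≥0∞) : Prop where
  aemeasurable : ∀ n, AEMeasurable (X n) P
  strictMono : ∀ᵐ ω ∂P, ∀ n, StrictMono (X n ω)
  measurable_weight : Measurable g
  weight_ne_top : ∀ x, g x ≠ ∞
  weight_ne_zero : ∀ x, StrictMono x → g x ≠ 0
  weight_ae_ne_zero : ∀ᵐ x, g x ≠ 0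
  lintegral_step : ∀ (n : ℕ) (F : (ℕ → Fin N → ℝ) → ℝ≥0∞), Measurable F →
    DependsOn F (Iic (n + 1)) →
    ∫⁻ ω, F (fun l => X l ω) ∂P = ∫⁻ ω, (∫⁻ y, c * g y * (g (X n ω))⁻¹ *
      {y | WeakInterlace (X n ω) y}.indicator 1 y * F (update (fun l => X l ω) (n + 1) y)) ∂P

section Chain

variable {Ω : Type*} [MeasurableSpace Ω] {X : ℕ → Ω → Fin N → ℝ}
  {P : Measure Ω} {c : ℝ≥0∞} {g : (Fin N → ℝ) → ℝ≥0∞}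

lemma measurable_levelWeight (hg : Measurable g) (n : ℕ) : Measurable (levelWeight c g n) := by
  unfold levelWeight; fun_prop

/-- The one-step densities telescope: every intermediate value of `g` cancels, and only the two ends
of the path remain in the weight. -/
lemma IsInterlacingChain.lintegral_eq (hX : IsInterlacingChain X P c g) (n : ℕ)
    {F : (ℕ → Fin N → ℝ) → ℝ≥0∞} (hF : Measurable F) (hd : DependsOn F (Iic n)) :
    ∫⁻ ω, F (fun l => X l ω) ∂P =
      ∫⁻ ω, (∫⋯∫⁻_Finset.Icc 1 n, fun s => levelWeight c g n s * (chain N n).indicator F s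
        ∂(fun _ => volume)) (fun l => X l ω) ∂P := by
  have hgm := hX.measurable_weight
  induction n generalizing F with
  | zero =>
    refine lintegral_congr_ae ?_
    filter_upwards [hX.strictMono] with ω hω
    have h0 := hX.weight_ne_zero _ (hω 0)
    simp [levelWeight, chain, ENNReal.mul_inv_cancel h0 (hX.weight_ne_top _)]
  | succ n ih =>
    let W : Set ((ℕ → Fin N → ℝ) × (Fin N → ℝ)) := {p | WeakInterlace (p.1 n) p.2}
    have hW : MeasurableSet W := measurableSet_weakInterlace (by fun_prop) (by fun_prop)
    -- Integrating out level `n + 1` leaves a functional of the levels up to `n`, to which the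
    -- induction hypothesis applies.
    let F' : (ℕ → Fin N → ℝ) → ℝ≥0∞ := fun s => ∫⁻ y, c * g y * (g (s n))⁻¹ *
      {y | WeakInterlace (s n) y}.indicator 1 y * F (update s (n + 1) y)
    have hup : Measurable fun p : (ℕ → Fin N → ℝ) × (Fin N → ℝ) => update p.1 (n + 1) p.2 := by
      refine measurable_pi_iff.2 fun l => ?_
      by_cases h : l = n + 1
      · subst h; simpa using measurable_snd
      · simp only [update_of_ne h]; fun_prop
    have hF'm : Measurable F' := by
      refine Measurable.lintegral_prod_right'
        (f := fun p : (ℕ → Fin N → ℝ) × (Fin N → ℝ) => c * g p.2 * (g (p.1 n))⁻¹ *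
          W.indicator 1 p * F (update p.1 (n + 1) p.2)) ?_
      have h1 : Measurable (W.indicator (1 : (ℕ → Fin N → ℝ) × (Fin N → ℝ) → ℝ≥0∞)) :=
        measurable_one.indicator hW
      have h2 := hF.comp hup
      exact Measurable.mul (Measurable.mul (by fun_prop) h1) h2
    have hF'd : DependsOn F' (Iic n) := by
      intro s s' h
      have hn : s n = s' n := h n (by simp)
      simp only [F', hn]
      refine lintegral_congr fun y => ?_
      congr 1
      refine hd fun l hl => ?_
      by_cases h' : l = n + 1
      · simp [h']
      · simp only [update_of_ne h']
        exact h l (by simp only [mem_Iic] at hl ⊢; omega)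
    rw [hX.lintegral_step n F hF hd]
    change ∫⁻ ω, F' (fun l => X l ω) ∂P = _
    rw [ih hF'm hF'd]
    have hunion : Finset.Icc 1 (n + 1) = Finset.Icc 1 n ∪ {n + 1} := by
      ext l; simp; omega
    have hmeas : Measurable fun s => levelWeight c g (n + 1) s *
        (chain N (n + 1)).indicator F s :=
      (measurable_levelWeight hgm _).mul (hF.indicator (measurableSet_chain _))
    -- The telescoping: `g (s n)` ends the old weight and is inverted in the new step, so it must be
    -- nonzero to cancel.
    have key : ∀ s : ℕ → Fin N → ℝ, g (s n) ≠ 0 →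
        levelWeight c g n s * (chain N n).indicator F' s =
        (∫⋯∫⁻_{n + 1}, fun s => levelWeight c g (n + 1) s * (chain N (n + 1)).indicator F s
          ∂(fun _ => volume)) s := by
      intro s hs
      rw [lmarginal_singleton]
      by_cases hc : s ∈ chain N n
      · have hmeas' : Measurable fun y => c * g y * (g (s n))⁻¹ *
            {y | WeakInterlace (s n) y}.indicator 1 y * F (update s (n + 1) y) := by
          have h1 : Measurable ({y | WeakInterlace (s n) y}.indicator
            (1 : (Fin N → ℝ) → ℝ≥0∞)) :=
            measurable_one.indicator (measurableSet_weakInterlace (by fun_prop) (by fun_prop))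
          exact Measurable.mul (Measurable.mul (by fun_prop) h1)
            (hF.comp (measurable_update s))
        rw [indicator_of_mem hc, ← lintegral_const_mul _ hmeas']
        refine lintegral_congr fun y => ?_
        have hiff : update s (n + 1) y ∈ chain N (n + 1) ↔ WeakInterlace (s n) y := by
          constructor
          · intro h
            have := h n (by omega)
            simpa using this
          · intro h l hl
            rcases Nat.lt_succ_iff_lt_or_eq.1 hl with hl | rfl
            · have h1 : l ≠ n + 1 := by omega
              have h2 : l + 1 ≠ n + 1 := by omega
              simpa [update_of_ne h1, update_of_ne h2] using hc l hl
            · simpa using h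
        have h0 : (0 : ℕ) ≠ n + 1 := by omega
        by_cases hy : WeakInterlace (s n) y
        · rw [indicator_of_mem (hiff.2 hy), indicator_of_mem (s := {y | WeakInterlace (s n) y}) hy]
          simp only [levelWeight, update_self, update_of_ne h0, Pi.one_apply, mul_one]
          have := ENNReal.mul_inv_cancel hs (hX.weight_ne_top (s n))
          calc c ^ n * g (s n) * (g (s 0))⁻¹ * (c * g y * (g (s n))⁻¹ * F (update s (n + 1) y))
              = c ^ n * c * g y * (g (s 0))⁻¹ * F (update s (n + 1) y) *
                (g (s n) * (g (s n))⁻¹) := by ring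
            _ = _ := by rw [this]; ring
        · rw [indicator_of_notMem (fun h => hy (hiff.1 h)),
            indicator_of_notMem (s := {y | WeakInterlace (s n) y}) hy]
          simp
      · rw [indicator_of_notMem hc]
        have : ∀ y, update s (n + 1) y ∉ chain N (n + 1) := by
          intro y h
          refine hc fun l hl => ?_
          have h1 : l ≠ n + 1 := by omega
          have h2 : l + 1 ≠ n + 1 := by omega
          simpa [update_of_ne h1, update_of_ne h2] using h l (by omega)
        simp [this]
    refine lintegral_congr_ae ?_
    filter_upwards [hX.strictMono] with ω hω
    rw [hunion, lmarginal_union _ _ hmeas (by simp)]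
    -- For `n = 0` the value `g (s n)` is that of the random starting point, nonzero by strict
    -- ordering. For `n ≥ 1` level `n` is an integration variable, and `g ≠ 0` almost everywhere
    -- suffices.
    rcases Nat.eq_zero_or_pos n with rfl | hn
    · have h1 : Finset.Icc 1 0 = (∅ : Finset ℕ) := rfl
      rw [h1, lmarginal_empty, lmarginal_empty]
      exact key _ (hX.weight_ne_zero _ (hω 0))
    · refine lintegral_congr_ae ?_
      have hmem : n ∈ Finset.Icc 1 n := by simp; omega
      have := (Measure.quasiMeasurePreserving_eval
        (fun _ : {i // i ∈ Finset.Icc 1 n} => (volume : Measure (Fin N → ℝ))) ⟨n, hmem⟩).ae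
          hX.weight_ae_ne_zero
      filter_upwards [this] with y hy
      refine key _ ?_
      simpa [updateFinset, hmem] using hy

end Chain

end LaguerreField

end

noncomputable section

namespace LaguerreField

open Set Function

variable {N k a b : ℕ}

/-! ### The Gibbs property of an interlacing chain -/

section Gibbs

variable {Ω : Type*} [MeasurableSpace Ω] {X : ℕ → Ω → Fin N → ℝ}
  {P : Measure Ω} {c : ℝ≥0∞} {g : (Fin N → ℝ) → ℝ≥0∞}

/-- A family of sets `B o` of window configurations that, for every horizon `n ≥ b`, are the
sections of the set of interlacing sequences with strictly ordered window. -/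
structure IsWindowFamily (k : ℕ) (hk : k ≤ N) (a b : ℕ)
    (B : (OutsideIndex N k a b → ℝ) → Set (Config k a b)) : Prop where
  measurableSet : MeasurableSet {p : (OutsideIndex N k a b → ℝ) × Config k a b | p.2 ∈ B p.1}
  volume_ne_top : ∀ o, volume (B o) ≠ ∞
  congr : ∀ o o', (∀ p, p.1.2 ≤ b → o p = o' p) → B o = B o'
  section_iff : ∀ n, b ≤ n → ∃ D : Set (OutsideIndex N k a b → ℝ), ∀ o w,
    (assemble o w ∈ chain N n ∧ ∀ l, w l ∈ weyl k) ↔ (o ∈ D ∧ w ∈ B o)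

variable {hk : k ≤ N} {B : (OutsideIndex N k a b → ℝ) → Set (Config k a b)}

lemma IsWindowFamily.measurableSet_section (hB : IsWindowFamily k hk a b B)
    (o : OutsideIndex N k a b → ℝ) : MeasurableSet (B o) :=
  measurable_prodMk_left hB.measurableSet

lemma IsWindowFamily.measurable_volume (hB : IsWindowFamily k hk a b B) :
    Measurable fun o => volume (B o) :=
  measurable_measure_prodMk_left hB.measurableSet

/-- The average of `F` after resampling the window uniformly. -/
def resample (B : (OutsideIndex N k a b → ℝ) → Set (Config k a b))
    (F : (ℕ → Fin N → ℝ) → ℝ≥0∞) (o : OutsideIndex N k a b → ℝ) : ℝ≥0∞ :=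
  (volume (B o))⁻¹ * ∫⁻ w in B o, F (assemble o w)

lemma resample_eq (F : (ℕ → Fin N → ℝ) → ℝ≥0∞)
    (o : OutsideIndex N k a b → ℝ) :
    resample B F o = ∫⁻ w, F (assemble o w) ∂(ProbabilityTheory.cond volume (B o)) := by
  rw [resample, ProbabilityTheory.cond, lintegral_smul_measure, smul_eq_mul]

lemma measurable_resample (hB : IsWindowFamily k hk a b B) {F : (ℕ → Fin N → ℝ) → ℝ≥0∞}
    (hF : Measurable F) : Measurable (resample B F) := by
  refine hB.measurable_volume.inv.mul ?_
  have h1 : Measurable fun p : (OutsideIndex N k a b → ℝ) × Config k a b =>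
      {p : (OutsideIndex N k a b → ℝ) × Config k a b | p.2 ∈ B p.1}.indicator
        (fun p => F (assemble p.1 p.2)) p :=
    (hF.comp measurable_assemble).indicator hB.measurableSet
  have h2 : (fun o => ∫⁻ w in B o, F (assemble o w)) = fun o => ∫⁻ w,
      {p : (OutsideIndex N k a b → ℝ) × Config k a b | p.2 ∈ B p.1}.indicator
        (fun p => F (assemble p.1 p.2)) (o, w) := by
    ext o
    rw [← lintegral_indicator (hB.measurableSet_section o)]
    rfl
  rw [h2]
  exact h1.lintegral_prod_right' (ν := volume)

lemma dependsOn_resample (hB : IsWindowFamily k hk a b B) {F : (ℕ → Fin N → ℝ) → ℝ≥0∞}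
    {n : ℕ} (hn : b ≤ n) (hd : DependsOn F (Iic n)) :
    DependsOn (fun s => resample B F (offWindow k a b s)) (Iic n) := by
  intro s s' h
  have hBs : B (offWindow k a b s) = B (offWindow k a b s') :=
    hB.congr _ _ fun p hp => congrFun (h _ (by simp only [mem_Iic]; omega)) _
  simp only [resample, hBs]
  congr 1
  refine lintegral_congr fun w => hd fun l hl => ?_
  ext j
  simp only [assemble, offWindow]
  split_ifs
  · rfl
  · exact congrFun (h l hl) j

/-- The weight sees only levels `0` and `n`, both outside the window. As a function of `w` the
integrand is a constant times `F` on `B o`, and `F` has the same integral over `B o` as its mean. -/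
lemma lintegral_window (hB : IsWindowFamily k hk a b B) {n : ℕ} (hn : b ≤ n)
    (F : (ℕ → Fin N → ℝ) → ℝ≥0∞) (hF : Measurable F) (s : ℕ → Fin N → ℝ) :
    ∫⁻ w : Config k a b, levelWeight c g n (glue k a b s w) * (chain N n).indicator
        ({s | ∀ l : Ioo a b, onWindow k hk a b s l ∈ weyl k}.indicator F) (glue k a b s w) =
      ∫⁻ w : Config k a b, levelWeight c g n (glue k a b s w) * (chain N n).indicator
        ({s | ∀ l : Ioo a b, onWindow k hk a b s l ∈ weyl k}.indicator
          (fun s => resample B F (offWindow k a b s))) (glue k a b s w) := by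
  obtain ⟨D, hD⟩ := hB.section_iff n hn
  have hw : ∀ w : Config k a b, levelWeight c g n (glue k a b s w) = levelWeight c g n s := by
    intro w
    have h1 : glue k a b s w n = s n := by
      ext j
      exact dif_neg fun h => absurd h.2.2 (by omega)
    have h2 : glue k a b s w 0 = s 0 := by
      ext j
      exact dif_neg fun h => absurd h.2.1 (by omega)
    simp only [levelWeight, h1, h2]
  set o := offWindow k a b s with ho
  have hind : ∀ (F' : (ℕ → Fin N → ℝ) → ℝ≥0∞) (w : Config k a b), (chain N n).indicator
      ({s | ∀ l : Ioo a b, onWindow k hk a b s l ∈ weyl k}.indicator F') (glue k a b s w) =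
      D.indicator 1 o * (B o).indicator (fun w => F' (assemble o w)) w := by
    intro F' w
    rw [glue_eq_assemble]
    have hmem : assemble o w ∈ {s | ∀ l : Ioo a b, onWindow k hk a b s l ∈ weyl k} ↔
        ∀ l, w l ∈ weyl k := by
      change (∀ l, onWindow k hk a b (assemble o w) l ∈ weyl k) ↔ _
      rw [onWindow_assemble]
    have := hD o w
    by_cases h : o ∈ D ∧ w ∈ B o
    · rw [indicator_of_mem (this.2 h).1, indicator_of_mem (hmem.2 (this.2 h).2),
        indicator_of_mem h.1, indicator_of_mem h.2]
      simp [ho]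
    · have h1 : D.indicator (1 : (OutsideIndex N k a b → ℝ) → ℝ≥0∞) o *
          (B o).indicator (fun w => F' (assemble o w)) w = 0 := by
        by_cases h3 : o ∈ D
        · rw [indicator_of_notMem (fun h4 => h ⟨h3, h4⟩), mul_zero]
        · rw [indicator_of_notMem h3, zero_mul]
      rw [h1]
      by_cases h3 : assemble o w ∈ chain N n
      · rw [← ho, indicator_of_mem h3,
          indicator_of_notMem fun h4 => h (this.1 ⟨h3, hmem.1 h4⟩)]
      · rw [← ho, indicator_of_notMem h3]
  simp only [hw, hind]
  have hBo := hB.measurableSet_section o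
  have hFo : Measurable fun w => F (assemble o w) :=
    (hF.comp measurable_assemble).comp (measurable_prodMk_left (x := o))
  rw [lintegral_const_mul _ ((hFo.indicator hBo).const_mul _),
    lintegral_const_mul _ ((Measurable.indicator (by
      simp only [offWindow_assemble]; fun_prop) hBo).const_mul _),
    lintegral_const_mul _ (hFo.indicator hBo),
    lintegral_const_mul _ (Measurable.indicator (by
      simp only [offWindow_assemble]; fun_prop) hBo),
    lintegral_indicator hBo, lintegral_indicator hBo]
  simp only [offWindow_assemble, lintegral_const, Measure.restrict_apply_univ]
  congr 2
  rw [resample]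
  -- On a null section `(volume (B o))⁻¹ = ∞`, but both sides vanish.
  by_cases h0 : volume (B o) = 0
  · rw [h0, mul_zero, setLIntegral_measure_zero _ _ h0]
  · rw [mul_comm _ (volume (B o)), ← mul_assoc,
      ENNReal.mul_inv_cancel h0 (hB.volume_ne_top o), one_mul]

/-- Invariance under uniform resampling, which is the Gibbs property in integrated form: in the path
integral the window may be integrated first. -/
lemma IsInterlacingChain.lintegral_eq_resample (hX : IsInterlacingChain X P c g)
    (hB : IsWindowFamily k hk a b B) {n : ℕ} (hn : b ≤ n)
    {F : (ℕ → Fin N → ℝ) → ℝ≥0∞} (hF : Measurable F) (hd : DependsOn F (Iic n)) :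
    ∫⁻ ω, F (fun l => X l ω) ∂P =
      ∫⁻ ω, resample B F (offWindow k a b fun l => X l ω) ∂P := by
  -- `chain` imposes only weak interlacing, whereas `B o` also demands strict ordering within the
  -- window. As `X` is almost surely strictly ordered, the indicator of `V` can be inserted for
  -- free.
  set V : Set (ℕ → Fin N → ℝ) := {s | ∀ l : Ioo a b, onWindow k hk a b s l ∈ weyl k} with hV
  have hVm : MeasurableSet V := by
    rw [hV, ofPred_forall]
    exact MeasurableSet.iInter fun l =>
      measurableSet_strictMono ((measurable_pi_apply l).comp (measurable_onWindow hk))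
  have hVd : ∀ G : (ℕ → Fin N → ℝ) → ℝ≥0∞, DependsOn G (Iic n) →
      DependsOn (V.indicator G) (Iic n) := by
    intro G hG s s' h
    have hmem : s ∈ V ↔ s' ∈ V := by
      refine forall_congr' fun l => ?_
      have : s l = s' l := h l (by have := l.2.2; simp only [mem_Iic]; omega)
      simp [onWindow, this]
    by_cases hs : s ∈ V
    · rw [indicator_of_mem hs, indicator_of_mem (hmem.1 hs), hG h]
    · rw [indicator_of_notMem hs, indicator_of_notMem (fun h' => hs (hmem.2 h'))]
  have hVX : ∀ G : (ℕ → Fin N → ℝ) → ℝ≥0∞, ∫⁻ ω, G (fun l => X l ω) ∂P =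
      ∫⁻ ω, V.indicator G (fun l => X l ω) ∂P := by
    intro G
    refine lintegral_congr_ae ?_
    filter_upwards [hX.strictMono] with ω hω
    rw [indicator_of_mem]
    intro l i j hij
    exact hω l (by simpa using hij)
  have hR : Measurable fun s => resample B F (offWindow k a b s) :=
    (measurable_resample hB hF).comp measurable_offWindow
  have hRd := dependsOn_resample hB hn hd
  rw [hVX F, hVX fun s => resample B F (offWindow k a b s),
    hX.lintegral_eq n (hF.indicator hVm) (hVd _ hd),
    hX.lintegral_eq n (hR.indicator hVm) (hVd _ hRd)]
  -- The window starts at `a + 1 ≥ 1`, so it never meets level `0`, whose law is arbitrary.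
  have hsub : Finset.Ioo a b ⊆ Finset.Icc 1 n := by
    intro l; simp; omega
  have hm : ∀ G : (ℕ → Fin N → ℝ) → ℝ≥0∞, Measurable G → Measurable fun s =>
      levelWeight c g n s * (chain N n).indicator (V.indicator G) s := fun G hG =>
    (measurable_levelWeight hX.measurable_weight n).mul
      ((hG.indicator hVm).indicator (measurableSet_chain n))
  rw [lmarginal_eq_of_subset hsub (hm F hF) (hm _ hR)]
  ext s
  rw [lmarginal_Ioo_eq hk (hm F hF), lmarginal_Ioo_eq hk (hm _ hR)]
  exact lintegral_congr fun r => lintegral_window hB hn F hF _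

/-- Resample the indicator of the event that the section is null. The event is determined by the
outside, and on it the resampled value is `∞ * 0 = 0`, so its probability is zero. -/
lemma IsInterlacingChain.ae_volume_pos (hX : IsInterlacingChain X P c g)
    (hB : IsWindowFamily k hk a b B) :
    ∀ᵐ ω ∂P, 0 < volume (B (offWindow k a b fun l => X l ω)) := by
  set T : Set (ℕ → Fin N → ℝ) := {s | volume (B (offWindow k a b s)) = 0} with hT
  have hTm : MeasurableSet T :=
    (hB.measurable_volume.comp measurable_offWindow) (measurableSet_singleton 0)
  have hd : DependsOn (T.indicator (1 : (ℕ → Fin N → ℝ) → ℝ≥0∞)) (Iic b) := by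
    intro s s' h
    have hBs : B (offWindow k a b s) = B (offWindow k a b s') :=
      hB.congr _ _ fun p hp => congrFun (h _ hp) _
    simp [indicator, hT, hBs]
  have hXm : AEMeasurable (fun ω l => X l ω) P := aemeasurable_pi_iff.2 hX.aemeasurable
  have h := hX.lintegral_eq_resample hB le_rfl (measurable_one.indicator hTm) hd
  have h0 : ∀ o, resample B (T.indicator 1) o = 0 := by
    intro o
    by_cases ho : volume (B o) = 0
    · rw [resample, setLIntegral_measure_zero _ _ ho, mul_zero]
    · simp [resample, indicator, hT, offWindow_assemble, ho]
  simp only [h0, lintegral_zero] at h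
  have h1 : AEMeasurable (fun ω => T.indicator (1 : (ℕ → Fin N → ℝ) → ℝ≥0∞) fun l => X l ω) P :=
    (measurable_one.indicator hTm).comp_aemeasurable hXm
  rw [lintegral_eq_zero_iff' h1] at h
  filter_upwards [h] with ω hω
  rw [pos_iff_ne_zero]
  intro h'
  have : (fun l => X l ω) ∈ T := h'
  simp [indicator_of_mem this] at hω

/-- The kernel that samples the window uniformly from `B o`. -/
def windowKernel (B : (OutsideIndex N k a b → ℝ) → Set (Config k a b)) :
    Kernel (OutsideIndex N k a b → ℝ) (Config k a b) :=
  Kernel.withDensity (Kernel.const _ volume) fun o w =>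
    (volume (B o))⁻¹ * (B o).indicator 1 w

lemma windowKernel_apply (hB : IsWindowFamily k hk a b B) (o : OutsideIndex N k a b → ℝ) :
    windowKernel B o = ProbabilityTheory.cond volume (B o) := by
  have h1 : Measurable (uncurry fun (o : OutsideIndex N k a b → ℝ) w =>
      (volume (B o))⁻¹ * (B o).indicator (1 : Config k a b → ℝ≥0∞) w) := by
    refine (hB.measurable_volume.inv.comp measurable_fst).mul ?_
    exact (measurable_one (α := ℝ≥0∞)).indicator hB.measurableSet
  rw [windowKernel, Kernel.withDensity_apply _ h1, Kernel.const_apply, ProbabilityTheory.cond]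
  have : (fun w => (volume (B o))⁻¹ * (B o).indicator (1 : Config k a b → ℝ≥0∞) w) =
      (volume (B o))⁻¹ • (B o).indicator (1 : Config k a b → ℝ≥0∞) := rfl
  rw [this, withDensity_smul _ (measurable_one.indicator (hB.measurableSet_section o)),
    withDensity_indicator_one (hB.measurableSet_section o)]

/-- The kernel is the zero measure on null sections, hence finite with bound `1` but not in general
Markov. -/
lemma isFiniteKernel_windowKernel (hB : IsWindowFamily k hk a b B) :
    IsFiniteKernel (windowKernel B) := by
  refine ⟨1, ENNReal.one_lt_top, fun o => ?_⟩
  rw [windowKernel_apply hB, ProbabilityTheory.cond]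
  simp only [Measure.smul_apply, Measure.restrict_apply_univ, smul_eq_mul]
  exact ENNReal.inv_mul_le_one _

/-- The resampling identity says that the law of `X` is obtained by drawing the outside and then the
window from the kernel. Splitting the sequence again yields a disintegration, and conditional
distributions are almost surely unique. -/
lemma IsInterlacingChain.condDistrib_eq [IsProbabilityMeasure P]
    (hX : IsInterlacingChain X P c g) (hB : IsWindowFamily k hk a b B) :
    ∀ᵐ ω ∂P, condDistrib (inside X k hk a b) (outside X k a b) P (outside X k a b ω) =
      ProbabilityTheory.cond volume (B (outside X k a b ω)) := by
  have := isFiniteKernel_windowKernel hB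
  have hXm : AEMeasurable (fun ω l => X l ω) P := aemeasurable_pi_iff.2 hX.aemeasurable
  have hin : inside X k hk a b = fun ω => onWindow k hk a b (fun l => X l ω) := rfl
  have hout : outside X k a b = fun ω => offWindow k a b (fun l => X l ω) := rfl
  have hinm : AEMeasurable (inside X k hk a b) P := (measurable_onWindow hk).comp_aemeasurable hXm
  have houtm : AEMeasurable (outside X k a b) P := measurable_offWindow.comp_aemeasurable hXm
  have hmeas : Measurable fun s : ℕ → Fin N → ℝ =>
      (offWindow k a b s, onWindow k hk a b s) :=
    measurable_offWindow.prodMk (measurable_onWindow hk)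
  set ρ := P.map (outside X k a b) ⊗ₘ windowKernel B with hρ
  have hlaw : P.map (fun ω l => X l ω) = ρ.map fun p => assemble p.1 p.2 := by
    have : IsProbabilityMeasure (P.map (fun ω l => X l ω)) :=
      Measure.isProbabilityMeasure_map hXm
    have hset : ∀ A : Set (ℕ → Fin N → ℝ), MeasurableSet A →
        ∀ n, b ≤ n → DependsOn (A.indicator (1 : (ℕ → Fin N → ℝ) → ℝ≥0∞)) (Iic n) →
        P.map (fun ω l => X l ω) A = ρ.map (fun p => assemble p.1 p.2) A := by
      intro A hA n hn hd
      rw [← lintegral_indicator_one hA, ← lintegral_indicator_one hA,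
        lintegral_map' (measurable_one.indicator hA).aemeasurable hXm,
        lintegral_map (measurable_one.indicator hA) measurable_assemble,
        hX.lintegral_eq_resample hB hn (measurable_one.indicator hA) hd,
        Measure.lintegral_compProd
          (f := fun p => A.indicator (1 : (ℕ → Fin N → ℝ) → ℝ≥0∞) (assemble p.1 p.2))
          ((measurable_one.indicator hA).comp measurable_assemble)]
      simp only [windowKernel_apply hB, ← resample_eq]
      rw [lintegral_map' (measurable_resample hB (measurable_one.indicator hA)).aemeasurable houtm]
      rfl
    -- A cylinder depends on finitely many levels, so it has a finite horizon `max m b`; cylinders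
    -- determine the law on all levels.
    refine ext_of_generate_finite _ generateFrom_measurableCylinders.symm
      isPiSystem_measurableCylinders (fun A hA => ?_)
        (hset univ MeasurableSet.univ b le_rfl ?_)
    · rw [measurableCylinders_nat] at hA
      simp only [mem_iUnion, mem_singleton_iff] at hA
      obtain ⟨m, S, hS, rfl⟩ := hA
      refine hset _ (hS.cylinder _) (max m b) (le_max_right _ _) fun s s' h => ?_
      have : (Finset.Iic m).restrict s = (Finset.Iic m).restrict s' := by
        ext1 l
        have := l.2
        exact h l (by simp only [Finset.mem_Iic, mem_Iic] at this ⊢; omega)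
      have hm : s ∈ cylinder (Finset.Iic m) S ↔ s' ∈ cylinder (Finset.Iic m) S := by
        rw [mem_cylinder, mem_cylinder, this]
      by_cases hs : s ∈ cylinder (Finset.Iic m) S
      · rw [indicator_of_mem hs, indicator_of_mem (hm.1 hs)]
        rfl
      · rw [indicator_of_notMem hs, indicator_of_notMem fun h' => hs (hm.2 h')]
    · intro s s' h
      simp
  have hjoint : P.map (fun ω => (outside X k a b ω, inside X k hk a b ω)) = ρ := by
    have h1 : (fun ω => (outside X k a b ω, inside X k hk a b ω)) =
        (fun s : ℕ → Fin N → ℝ => (offWindow k a b s, onWindow k hk a b s)) ∘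
          fun ω l => X l ω := rfl
    rw [h1, ← AEMeasurable.map_map_of_aemeasurable hmeas.aemeasurable hXm, hlaw,
      Measure.map_map hmeas measurable_assemble]
    have : (fun s : ℕ → Fin N → ℝ => (offWindow k a b s, onWindow k hk a b s)) ∘
        (fun p : (OutsideIndex N k a b → ℝ) × Config k a b => assemble p.1 p.2) = id := by
      ext1 p
      simp [offWindow_assemble, onWindow_assemble]
    rw [this, Measure.map_id]
  have := ae_of_ae_map houtm (condDistrib_ae_eq_of_measure_eq_compProd _ hinm hjoint)
  filter_upwards [this] with ω hω
  rw [hω, windowKernel_apply hB]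

end Gibbs

end LaguerreField

end

noncomputable section

namespace LaguerreField

open Set Function

variable {N k a b : ℕ}

/-! ### The interlacing sets as window families -/

lemma assemble_eq_of_notMem (o : OutsideIndex N k a b → ℝ) (w w' : Config k a b) {l : ℕ}
    {j : Fin N} (h : ¬((j : ℕ) < k ∧ l ∈ Set.Ioo a b)) : assemble o w l j = assemble o w' l j := by
  simp only [assemble, dif_neg h]

lemma assemble_offWindow_of_notMem (s : ℕ → Fin N → ℝ) (w : Config k a b) {l : ℕ}
    {j : Fin N} (h : ¬((j : ℕ) < k ∧ l ∈ Set.Ioo a b)) :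
    assemble (offWindow k a b s) w l j = s l j := by
  simp only [assemble, dif_neg h]
  rfl

/-- The configurations `w` of the window such that the lowest `m` particles interlace at the
levels from `a` to `b`. -/
def windowSet (m : ℕ) (hm : m ≤ N) (o : OutsideIndex N k a b → ℝ) : Set (Config k a b) :=
  {w | (∀ ℓ, w ℓ ∈ weyl k) ∧ ∀ ℓ, a ≤ ℓ → ℓ < b →
    WeakInterlace (lowest m hm (assemble o w ℓ)) (lowest m hm (assemble o w (ℓ + 1)))}

/-- An inequality involving a window coordinate involves only particles of index at most `k` and
levels from `a` to `b`. By `hmk` it therefore concerns the lowest `m` particles: either particle `k`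
is among them, or there is no such particle. -/
lemma isWindowFamily_windowSet (hk : k ≤ N) {m : ℕ} (hm : m ≤ N) (hkm : k ≤ m)
    (hmk : k < m ∨ k = N) : IsWindowFamily k hk a b (windowSet m hm) where
  measurableSet := by
    unfold windowSet
    have h1 : ∀ l, Measurable fun p : (OutsideIndex N k a b → ℝ) × Config k a b =>
        lowest m hm (assemble p.1 p.2 l) := fun l => by
      have := (measurable_pi_apply l).comp (measurable_assemble (N := N) (k := k) (a := a) (b := b))
      unfold lowest
      exact measurable_pi_iff.2 fun j => (measurable_pi_apply (Fin.castLE hm j)).comp this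
    refine MeasurableSet.inter
      (s₁ := {p : (OutsideIndex N k a b → ℝ) × Config k a b | ∀ ℓ, StrictMono (p.2 ℓ)})
      (s₂ := {p : (OutsideIndex N k a b → ℝ) × Config k a b | ∀ ℓ, a ≤ ℓ → ℓ < b →
        WeakInterlace (lowest m hm (assemble p.1 p.2 ℓ))
          (lowest m hm (assemble p.1 p.2 (ℓ + 1)))}) ?_ ?_
    · simp only [ofPred_forall]
      exact MeasurableSet.iInter fun l => measurableSet_strictMono (by fun_prop)
    · simp only [ofPred_forall]
      exact MeasurableSet.iInter fun l => MeasurableSet.iInter fun _ =>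
        MeasurableSet.iInter fun _ => measurableSet_weakInterlace (h1 _) (h1 _)
  volume_ne_top o := by
    refine ne_top_of_le_ne_top (isCompact_Icc
      (a := fun (_ : Ioo a b) (j : Fin k) => assemble o 0 a (Fin.castLE hk j))
      (b := fun (_ : Ioo a b) (j : Fin k) => assemble o 0 b (Fin.castLE hk j))).measure_ne_top
      (measure_mono fun w hw => ?_)
    have hstep : ∀ l, a ≤ l → l < b → ∀ j : Fin k,
        assemble o w l (Fin.castLE hk j) ≤ assemble o w (l + 1) (Fin.castLE hk j) :=
      fun l h1 h2 j => (hw.2 l h1 h2).1 (Fin.castLE hkm j)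
    have hmono : ∀ l₁, a ≤ l₁ → ∀ l₂, l₁ ≤ l₂ → l₂ ≤ b → ∀ j : Fin k,
        assemble o w l₁ (Fin.castLE hk j) ≤ assemble o w l₂ (Fin.castLE hk j) := by
      intro l₁ h1 l₂ h2
      induction l₂, h2 using Nat.le_induction with
      | base => exact fun _ _ => le_rfl
      | succ l hl ih =>
        exact fun hb j => (ih (by omega) j).trans (hstep l (by omega) (by omega) j)
    have hval : ∀ (l : Ioo a b) (j : Fin k), assemble o w l (Fin.castLE hk j) = w l j := by
      intro l j
      exact dif_pos (⟨j.2, l.2⟩ : ((Fin.castLE hk j : Fin N) : ℕ) < k ∧ (l : ℕ) ∈ Set.Ioo a b)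
    constructor
    · intro l j
      have := hmono a le_rfl l l.2.1.le l.2.2.le j
      rw [hval] at this
      rwa [← assemble_eq_of_notMem o 0 w (l := a) (by simp)] at this
    · intro l j
      have := hmono l l.2.1.le b l.2.2.le le_rfl j
      rw [hval] at this
      rwa [← assemble_eq_of_notMem o 0 w (l := b) (by simp)] at this
  congr o o' h := by
    have h1 : ∀ (w : Config k a b) l, l ≤ b → assemble o w l = assemble o' w l := by
      intro w l hl
      ext j
      simp only [assemble]
      split_ifs
      · rfl
      · exact h _ hl
    ext w
    refine and_congr_right fun _ => forall_congr' fun l => forall_congr' fun _ =>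
      forall_congr' fun hl => ?_
    rw [h1 w l hl.le, h1 w (l + 1) hl]
  section_iff n hn := by
    refine ⟨{o | ∀ l < n, (∀ i : Fin N, (m ≤ i ∨ l < a ∨ b ≤ l) →
        assemble o 0 l i ≤ assemble o 0 (l + 1) i) ∧
      ∀ i j : Fin N, (i : ℕ) + 1 = j → (m ≤ j ∨ l < a ∨ b ≤ l) →
        assemble o 0 (l + 1) i ≤ assemble o 0 l j}, fun o w => ?_⟩
    have key : ∀ l (i : Fin N), (k ≤ i ∨ l ≤ a ∨ b ≤ l) → assemble o 0 l i = assemble o w l i :=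
      fun l i h => assemble_eq_of_notMem o 0 w (by simp only [mem_Ioo]; omega)
    constructor
    · rintro ⟨hc, hw⟩
      refine ⟨fun l hl => ⟨fun i hi => ?_, fun i j hij hi => ?_⟩, hw, fun l h1 h2 => ⟨?_, ?_⟩⟩
      · rw [key l i (by omega), key (l + 1) i (by omega)]
        exact (hc l hl).1 i
      · have := j.2
        rw [key l j (by omega), key (l + 1) i (by omega)]
        exact (hc l hl).2 i j hij
      · exact fun i => (hc l (by omega)).1 _
      · exact fun i j hij => (hc l (by omega)).2 _ _ hij
    · rintro ⟨hD, hw, hI⟩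
      refine ⟨fun l hl => ⟨fun i => ?_, fun i j hij => ?_⟩, hw⟩
      · by_cases h : m ≤ i ∨ l < a ∨ b ≤ l
        · have := (hD l hl).1 i h
          rwa [key l i (by omega), key (l + 1) i (by omega)] at this
        · exact (hI l (by omega) (by omega)).1 ⟨i, by omega⟩
      · by_cases h : m ≤ j ∨ l < a ∨ b ≤ l
        · have h1 := j.2
          have h2 := (hD l hl).2 i j hij h
          rwa [key l j (by omega), key (l + 1) i (by omega)] at h2
        · exact (hI l (by omega) (by omega)).2 ⟨i, by omega⟩ ⟨j, by omega⟩ hij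

lemma path_eq_assemble (hk : k ≤ N) (s : ℕ → Fin N → ℝ) (w : Config k a b) {l : ℕ} (h1 : a ≤ l)
    (h2 : l ≤ b) (j : Fin k) :
    path (lowest k hk (s a)) (lowest k hk (s b)) w l j =
      assemble (offWindow k a b s) w l (Fin.castLE hk j) := by
  unfold path
  split_ifs with h h'
  · have h' : ((Fin.castLE hk j : Fin N) : ℕ) < k ∧ l ∈ Set.Ioo a b := ⟨j.2, h⟩
    simp only [assemble, dif_pos h']
    rfl
  · obtain rfl : l = a := by omega
    rw [assemble_offWindow_of_notMem _ _ (by simp)]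
    rfl
  · obtain rfl : l = b := by simp only [mem_Ioo] at h; omega
    rw [assemble_offWindow_of_notMem _ _ (by simp)]
    rfl

lemma interlacingSet_eq_windowSet (s : ℕ → Fin N → ℝ) :
    interlacingSet a b (s a) (s b) = windowSet N le_rfl (offWindow N a b s) := by
  ext w
  refine and_congr_right fun _ => forall_congr' fun l => forall_congr' fun h1 =>
    forall_congr' fun h2 => ?_
  have h : ∀ l, a ≤ l → l ≤ b → path (s a) (s b) w l =
      lowest N le_rfl (assemble (offWindow N a b s) w l) :=
    fun l h1 h2 => funext fun j => path_eq_assemble le_rfl s w h1 h2 j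
  rw [h l h1 h2.le, h (l + 1) (by omega) h2]

lemma interlacingSetTop_eq_windowSet (hk : k < N) (s : ℕ → Fin N → ℝ) :
    interlacingSetTop a b (lowest k hk.le (s a)) (lowest k hk.le (s b)) (fun l => s l ⟨k, hk⟩) =
      windowSet (k + 1) hk (offWindow k a b s) := by
  ext w
  refine and_congr_right fun _ => forall_congr' fun l => forall_congr' fun h1 =>
    forall_congr' fun h2 => ?_
  have h : ∀ l, a ≤ l → l ≤ b →
      (Fin.snoc (path (lowest k hk.le (s a)) (lowest k hk.le (s b)) w l) (s l ⟨k, hk⟩) :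
        Fin (k + 1) → ℝ) = lowest (k + 1) hk (assemble (offWindow k a b s) w l) := by
    intro l h1 h2
    ext j
    refine Fin.lastCases ?_ (fun j => ?_) j
    · rw [Fin.snoc_last]
      exact (assemble_offWindow_of_notMem s w (j := ⟨k, hk⟩) (by simp)).symm
    · rw [Fin.snoc_castSucc, path_eq_assemble hk.le s w h1 h2]
      rfl
  rw [h l h1 h2.le, h (l + 1) (by omega) h2]

theorem IsInterlacingChain.exponentialGibbs {Ω : Type*} [MeasurableSpace Ω]
    {X : ℕ → Ω → Fin N → ℝ} {P : Measure Ω} [IsProbabilityMeasure P] {c : ℝ≥0∞}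
    {g : (Fin N → ℝ) → ℝ≥0∞} (hX : IsInterlacingChain X P c g)
    (hpos : ∀ᵐ ω ∂P, ∀ n i, 0 < X n ω i) : ExponentialGibbs X P where
  aemeasurable := hX.aemeasurable
  mem_weylPos := by
    filter_upwards [hX.strictMono, hpos] with ω h1 h2 n using ⟨h1 n, h2 n⟩
  ZTop_pos k _ hk a b _ := by
    filter_upwards [hX.ae_volume_pos (isWindowFamily_windowSet (a := a) (b := b) hk.le hk
      (Nat.le_succ k) (Or.inl k.lt_succ_self))] with ω hω
    rw [ZTop]
    rwa [← interlacingSetTop_eq_windowSet] at hω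
  condLaw_top k _ hk a b _ := by
    filter_upwards [hX.condDistrib_eq (isWindowFamily_windowSet (a := a) (b := b) hk.le hk
      (Nat.le_succ k) (Or.inl k.lt_succ_self))] with ω hω
    rw [hω, bridgeLawTop]
    congr 1
    exact (interlacingSetTop_eq_windowSet hk fun l => X l ω).symm
  Z_pos a b _ := by
    filter_upwards [hX.ae_volume_pos (isWindowFamily_windowSet (a := a) (b := b) le_rfl le_rfl
      le_rfl (Or.inr rfl))] with ω hω
    rw [Z]
    rwa [← interlacingSet_eq_windowSet] at hω
  condLaw a b _ := by
    filter_upwards [hX.condDistrib_eq (isWindowFamily_windowSet (a := a) (b := b) le_rfl le_rfl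
      le_rfl (Or.inr rfl))] with ω hω
    rw [hω, bridgeLaw]
    congr 1
    exact (interlacingSet_eq_windowSet fun l => X l ω).symm

end LaguerreField

end

noncomputable section

namespace LaguerreField

open Polynomial

variable {N : ℕ}

/-! ### Interlacing roots of the secular equation -/

section Polynomials

variable {K : Type*} [Field K]

/-- The monic polynomial with roots `x`. -/
def rootPoly (x : Fin N → K) : K[X] := ∏ j, (X - C (x j))

/-- The characteristic polynomial of `diagonal x + v vᴴ` with `r i = ‖v i‖ ^ 2`. -/
def secularPoly (x r : Fin N → K) : K[X] :=
  rootPoly x - ∑ i, C (r i) * ∏ j ∈ Finset.univ.erase i, (X - C (x j))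

lemma rootPoly_monic (x : Fin N → K) : (rootPoly x).Monic := monic_prod_X_sub_C x _

lemma rootPoly_degree (x : Fin N → K) : (rootPoly x).degree = N := by
  rw [rootPoly, degree_prod]; simp

lemma rootPoly_eval (x : Fin N → K) (z : K) : (rootPoly x).eval z = ∏ j, (z - x j) := by
  simp [rootPoly, eval_prod]

lemma degree_sum_erase_lt (hN : 0 < N) (x r : Fin N → K) :
    (∑ i, C (r i) * ∏ j ∈ Finset.univ.erase i, (X - C (x j))).degree < N := by
  rw [degree_lt_iff_coeff_zero]
  intro m hm
  rw [finsetSum_coeff]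
  refine Finset.sum_eq_zero fun i _ => ?_
  rw [coeff_C_mul, coeff_eq_zero_of_natDegree_lt, mul_zero]
  rw [natDegree_finsetProd_X_sub_C_eq_card]
  rw [Finset.card_erase_of_mem (Finset.mem_univ i)]
  simp
  omega

lemma secularPoly_eval (x r : Fin N → K) (z : K) : (secularPoly x r).eval z =
    ∏ j, (z - x j) - ∑ i, r i * ∏ j ∈ Finset.univ.erase i, (z - x j) := by
  simp [secularPoly, rootPoly_eval, eval_finsetSum, eval_prod]

lemma secularPoly_eval_self (x r : Fin N → K) (i : Fin N) : (secularPoly x r).eval (x i) =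
    -(r i * ∏ j ∈ Finset.univ.erase i, (x i - x j)) := by
  rw [secularPoly_eval, Finset.prod_eq_zero (Finset.mem_univ i) (sub_self _), zero_sub, neg_inj]
  refine Finset.sum_eq_single i (fun l _ hl => ?_) (by simp)
  rw [Finset.prod_eq_zero (Finset.mem_erase.2 ⟨hl.symm, Finset.mem_univ i⟩) (sub_self _), mul_zero]

/-- Both sides are monic of degree `N`, so their difference has degree below `N` and `N` distinct
nodes decide. -/
lemma rootPoly_eq_secularPoly {x y r u : Fin N → K} (hu : Function.Injective u)
    (h : ∀ i, (rootPoly y).eval (u i) = (secularPoly x r).eval (u i)) :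
    rootPoly y = secularPoly x r := by
  rcases Nat.eq_zero_or_pos N with rfl | hN
  · simp [rootPoly, secularPoly]
  refine eq_of_degree_sub_lt_of_eval_index_eq Finset.univ (hu.injOn) ?_ (fun i _ => h i)
  rw [secularPoly, Finset.card_fin, ← sub_add]
  refine (degree_add_le _ _).trans_lt (max_lt ?_ (degree_sum_erase_lt hN x r))
  rw [← rootPoly_degree y]
  exact degree_sub_lt_left (by rw [rootPoly_degree, rootPoly_degree]) (rootPoly_monic y).ne_zero
    (by rw [(rootPoly_monic y).leadingCoeff, (rootPoly_monic x).leadingCoeff])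

/-- Compare coefficients of `X ^ (N - 1)`: this is the trace identity for the rank one perturbation.
-/
lemma sum_eq_of_rootPoly_eq_secularPoly {x y r : Fin N → K}
    (h : rootPoly y = secularPoly x r) : ∑ i, r i = ∑ i, y i - ∑ i, x i := by
  rcases Nat.eq_zero_or_pos N with rfl | hN
  · simp
  have hc := congrArg (fun p => p.coeff (N - 1)) h
  have h1 : ∀ y : Fin N → K, (rootPoly y).coeff (N - 1) = -∑ i, y i := by
    intro y
    simpa [rootPoly] using prod_X_sub_C_coeff_card_pred (Finset.univ : Finset (Fin N)) y (by simpa using hN)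
  have h2 : (∑ i, C (r i) * ∏ j ∈ Finset.univ.erase i, (X - C (x j))).coeff (N - 1) =
      ∑ i, r i := by
    rw [finsetSum_coeff]
    refine Finset.sum_congr rfl fun i _ => ?_
    have hd : (∏ j ∈ Finset.univ.erase i, (X - C (x j))).natDegree = N - 1 := by
      rw [natDegree_finsetProd_X_sub_C_eq_card, Finset.card_erase_of_mem (Finset.mem_univ i)]
      simp
    have := (monic_prod_X_sub_C x (Finset.univ.erase i)).coeff_natDegree
    rw [coeff_C_mul, ← hd, this, mul_one]
  simp only [secularPoly, coeff_sub, h1, h2] at hc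
  linear_combination hc

end Polynomials

lemma eq_of_rootPoly_eq {K : Type*} [Field K] {f : ℝ → K} (hf : Function.Injective f)
    {y y' : Fin N → ℝ} (hy : Monotone y) (hy' : Monotone y')
    (h : rootPoly (f ∘ y) = rootPoly (f ∘ y')) : y = y' := by
  have hr : ∀ y : Fin N → ℝ, (rootPoly (f ∘ y)).roots =
      (Finset.univ.val.map y).map f := by
    intro y
    rw [rootPoly, roots_prod _ _ (Finset.prod_ne_zero_iff.2 fun i _ => X_sub_C_ne_zero _)]
    simp only [roots_X_sub_C]
    rw [Multiset.bind_singleton, Multiset.map_map]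
  have h1 := congrArg roots h
  rw [hr, hr] at h1
  have h2 := Multiset.map_injective hf h1
  rw [Fin.univ_val_map, Fin.univ_val_map, Multiset.coe_eq_coe] at h2
  exact List.ofFn_inj.1 (List.Perm.eq_of_sortedLE hy.sortedLE_ofFn hy'.sortedLE_ofFn h2)

/-- The vectors `y` with `x₁ < y₁ < x₂ < ⋯ < x_N < y_N`. -/
def strictInterlace (x : Fin N → ℝ) : Set (Fin N → ℝ) :=
  {y | (∀ i, x i < y i) ∧ ∀ i j : Fin N, (i : ℕ) + 1 = j → y i < x j}

/-- The weights `r` such that `rootPoly y` is `secularPoly x r`. -/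
def residues (x y : Fin N → ℝ) (i : Fin N) : ℝ :=
  -((∏ j, (x i - y j)) * (∏ j ∈ Finset.univ.erase i, (x i - x j))⁻¹)

lemma prod_erase_sub_ne_zero {x : Fin N → ℝ} (hx : Function.Injective x) (i : Fin N) :
    ∏ j ∈ Finset.univ.erase i, (x i - x j) ≠ 0 :=
  Finset.prod_ne_zero_iff.2 fun j hj =>
    sub_ne_zero.2 fun h => (Finset.mem_erase.1 hj).1 (hx h.symm)

lemma rootPoly_eq_secularPoly_residues {x : Fin N → ℝ} (hx : Function.Injective x)
    (y : Fin N → ℝ) : rootPoly y = secularPoly x (residues x y) := by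
  refine rootPoly_eq_secularPoly hx fun i => ?_
  rw [secularPoly_eval_self, rootPoly_eval, residues]
  field_simp [prod_erase_sub_ne_zero hx i]

lemma residues_eq_of_rootPoly_eq {x y r : Fin N → ℝ} (hx : Function.Injective x)
    (h : rootPoly y = secularPoly x r) : residues x y = r := by
  ext i
  have := congrArg (eval (x i)) h
  rw [secularPoly_eval_self, rootPoly_eval] at this
  rw [residues, this]
  field_simp [prod_erase_sub_ne_zero hx i]

lemma sum_residues {x : Fin N → ℝ} (hx : Function.Injective x) (y : Fin N → ℝ) :
    ∑ i, residues x y i = ∑ i, y i - ∑ i, x i :=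
  sum_eq_of_rootPoly_eq_secularPoly (rootPoly_eq_secularPoly_residues hx y)

lemma strictInterlace.lt {x y : Fin N → ℝ} (hx : StrictMono x) (hy : y ∈ strictInterlace x)
    {i j : Fin N} (hij : i < j) : y i < x j := by
  have hi : (i : ℕ) + 1 < N := by have := j.2; have : (i : ℕ) < j := hij; omega
  refine (hy.2 i ⟨i + 1, hi⟩ rfl).trans_le (hx.monotone ?_)
  exact Nat.succ_le_of_lt hij

lemma strictInterlace.strictMono {x y : Fin N → ℝ} (hx : StrictMono x)
    (hy : y ∈ strictInterlace x) : StrictMono y :=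
  fun _ j hij => (strictInterlace.lt hx hy hij).trans (hy.1 j)

/-- For `j ≠ i` the points `x j` and `y j` lie on the same side of `x i`, so each quotient `(x i - y
j) / (x i - x j)` is positive; the remaining factor is `y i - x i`. -/
lemma residues_pos {x y : Fin N → ℝ} (hx : StrictMono x) (hy : y ∈ strictInterlace x)
    (i : Fin N) : 0 < residues x y i := by
  have h1 : residues x y i =
      (y i - x i) * ∏ j ∈ Finset.univ.erase i, ((x i - y j) * (x i - x j)⁻¹) := by
    rw [residues, Finset.prod_mul_distrib, Finset.prod_inv_distrib,
      ← Finset.mul_prod_erase _ _ (Finset.mem_univ i)]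
    ring
  rw [h1]
  refine mul_pos (sub_pos.2 (hy.1 i)) (Finset.prod_pos fun j hj => ?_)
  rcases lt_or_gt_of_ne (Finset.mem_erase.1 hj).1 with h | h
  · exact mul_pos (sub_pos.2 (strictInterlace.lt hx hy h)) (inv_pos.2 (sub_pos.2 (hx h)))
  · exact mul_pos_of_neg_of_neg (sub_neg.2 ((hx h).trans (hy.1 j)))
      (inv_lt_zero.2 (sub_neg.2 (hx h)))

lemma residues_injOn {x : Fin N → ℝ} (hx : StrictMono x) :
    Set.InjOn (residues x) (strictInterlace x) := by
  intro y hy y' hy' h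
  refine eq_of_rootPoly_eq (f := id) Function.injective_id
    (strictInterlace.strictMono hx hy).monotone (strictInterlace.strictMono hx hy').monotone ?_
  change rootPoly y = rootPoly y'
  rw [rootPoly_eq_secularPoly_residues hx.injective, h,
    ← rootPoly_eq_secularPoly_residues hx.injective]

/-- From one node to the next, exactly one factor of `∏ (x i - x j)` changes sign. -/
lemma secularPoly_mul_neg {x r : Fin N → ℝ} (hx : StrictMono x) (hr : ∀ i, 0 < r i)
    {i i' : Fin N} (hi : (i : ℕ) + 1 = i') :
    (secularPoly x r).eval (x i) * (secularPoly x r).eval (x i') < 0 := by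
  have hne : i ≠ i' := fun h => by rw [h] at hi; omega
  have hlt : i < i' := Fin.lt_def.2 (by omega)
  have h1 : (Finset.univ.erase i).erase i' = (Finset.univ.erase i').erase i := Finset.erase_right_comm
  rw [secularPoly_eval_self, secularPoly_eval_self,
    ← Finset.mul_prod_erase (Finset.univ.erase i) _ (Finset.mem_erase.2 ⟨hne.symm, Finset.mem_univ i'⟩),
    ← Finset.mul_prod_erase (Finset.univ.erase i') _ (Finset.mem_erase.2 ⟨hne, Finset.mem_univ i⟩),
    h1]
  have h2 : 0 < (∏ j ∈ (Finset.univ.erase i').erase i, (x i - x j)) *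
      ∏ j ∈ (Finset.univ.erase i').erase i, (x i' - x j) := by
    rw [← Finset.prod_mul_distrib]
    refine Finset.prod_pos fun j hj => ?_
    simp only [Finset.mem_erase, Finset.mem_univ, and_true] at hj
    rcases lt_or_gt_of_ne hj.1 with h | h
    · exact mul_pos (sub_pos.2 (hx h)) (sub_pos.2 (hx (h.trans hlt)))
    · have h' : i' < j := by
        refine lt_of_le_of_ne (Fin.le_def.2 ?_) hj.2.symm
        have := Fin.lt_def.1 h
        omega
      exact mul_pos_of_neg_of_neg (sub_neg.2 (hx h)) (sub_neg.2 (hx h'))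
  have h3 : 0 < r i * r i' * (x i' - x i) ^ 2 :=
    mul_pos (mul_pos (hr _) (hr _)) (pow_pos (sub_pos.2 (hx hlt)) 2)
  nlinarith [mul_pos h3 h2]

lemma secularPoly_last_neg {x r : Fin N → ℝ} (hx : StrictMono x) (hr : ∀ i, 0 < r i)
    {i : Fin N} (hi : (i : ℕ) + 1 = N) : (secularPoly x r).eval (x i) < 0 := by
  rw [secularPoly_eval_self, neg_lt_zero]
  refine mul_pos (hr i) (Finset.prod_pos fun j hj => sub_pos.2 (hx ?_))
  refine lt_of_le_of_ne (Fin.le_def.2 ?_) (Finset.mem_erase.1 hj).1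
  have := j.2
  omega

lemma exists_secularPoly_pos {x r : Fin N → ℝ} (hx : StrictMono x) (hr : ∀ i, 0 < r i)
    {i : Fin N} (hi : (i : ℕ) + 1 = N) : ∃ z, x i < z ∧ 0 < (secularPoly x r).eval z := by
  have hle : ∀ j, x j ≤ x i := fun j => hx.monotone (Fin.le_def.2 (by have := j.2; omega))
  have hS : 0 ≤ ∑ j, r j := Finset.sum_nonneg fun j _ => (hr j).le
  -- At `z = x i + T` every `z - x j` is at least `T > ∑ r`, so `∑ r l / (z - x l) < 1`.
  set T := ∑ j, r j + 1 with hT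
  refine ⟨x i + T, by linarith, ?_⟩
  have hz : ∀ j, T ≤ x i + T - x j := fun j => by linarith [hle j]
  have hT0 : 0 < T := by linarith
  have hpos : 0 < ∏ j, (x i + T - x j) := Finset.prod_pos fun j _ => hT0.trans_le (hz j)
  rw [secularPoly_eval]
  have h1 : ∀ l, r l * ∏ j ∈ Finset.univ.erase l, (x i + T - x j) ≤
      r l * T⁻¹ * ∏ j, (x i + T - x j) := by
    intro l
    rw [← Finset.mul_prod_erase _ _ (Finset.mem_univ l), mul_assoc]
    refine mul_le_mul_of_nonneg_left ?_ (hr l).le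
    have h2 : 0 ≤ ∏ j ∈ Finset.univ.erase l, (x i + T - x j) :=
      Finset.prod_nonneg fun j _ => (hT0.trans_le (hz j)).le
    rw [← mul_assoc]
    refine le_mul_of_one_le_left h2 ?_
    rw [inv_mul_eq_div, one_le_div hT0]
    exact hz l
  have h2 := Finset.sum_le_sum fun l (_ : l ∈ Finset.univ) => h1 l
  rw [← Finset.sum_mul, ← Finset.sum_mul] at h2
  have h3 : (∑ j, r j) * T⁻¹ < 1 := by
    rw [← div_eq_mul_inv, div_lt_one hT0]
    linarith
  nlinarith

/-- The sign changes give a root in each gap of `x` and one above the top. These are `N` distinct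
roots of a monic polynomial of degree `N`, hence all of them. -/
lemma exists_residues_eq {x r : Fin N → ℝ} (hx : StrictMono x) (hr : ∀ i, 0 < r i) :
    ∃ y ∈ strictInterlace x, residues x y = r := by
  have hc : Continuous fun z => (secularPoly x r).eval z := (secularPoly x r).continuous
  have hex : ∀ i : Fin N, ∃ z, (secularPoly x r).eval z = 0 ∧ x i < z ∧
      ∀ j : Fin N, (i : ℕ) + 1 = j → z < x j := by
    intro i
    by_cases hi : (i : ℕ) + 1 = N
    · obtain ⟨z, hz, hpos⟩ := exists_secularPoly_pos hx hr hi
      obtain ⟨u, hu, hu0⟩ := intermediate_value_Ioo hz.le hc.continuousOn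
        ⟨secularPoly_last_neg hx hr hi, hpos⟩
      exact ⟨u, hu0, hu.1, fun j hj => absurd j.2 (by omega)⟩
    · have hi' : (i : ℕ) + 1 < N := by have := i.2; omega
      let j : Fin N := ⟨i + 1, hi'⟩
      have hlt : x i < x j := hx (Fin.lt_def.2 (Nat.lt_succ_self _))
      have hneg := secularPoly_mul_neg hx hr (i := i) (i' := j) rfl
      have : ∃ u ∈ Set.Ioo (x i) (x j), (secularPoly x r).eval u = 0 := by
        rcases mul_neg_iff.1 hneg with ⟨h1, h2⟩ | ⟨h1, h2⟩
        · exact intermediate_value_Ioo' hlt.le hc.continuousOn ⟨h2, h1⟩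
        · exact intermediate_value_Ioo hlt.le hc.continuousOn ⟨h1, h2⟩
      obtain ⟨u, hu, hu0⟩ := this
      refine ⟨u, hu0, hu.1, fun j' hj' => ?_⟩
      have : j' = j := Fin.ext hj'.symm
      rw [this]
      exact hu.2
  choose y hy0 hy1 hy2 using hex
  have hy : y ∈ strictInterlace x := ⟨hy1, hy2⟩
  refine ⟨y, hy, residues_eq_of_rootPoly_eq hx.injective ?_⟩
  refine rootPoly_eq_secularPoly (strictInterlace.strictMono hx hy).injective fun i => ?_
  rw [hy0, rootPoly_eval, Finset.prod_eq_zero (Finset.mem_univ i) (sub_self _)]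

lemma residues_image {x : Fin N → ℝ} (hx : StrictMono x) :
    residues x '' strictInterlace x = {r | ∀ i, 0 < r i} := by
  ext r
  constructor
  · rintro ⟨y, hy, rfl⟩
    exact residues_pos hx hy
  · exact fun hr => exists_residues_eq hx hr

end LaguerreField

end

noncomputable section

namespace LaguerreField

open Polynomial

variable {N : ℕ}

/-! ### The change of variables from residues to interlacing roots -/

/-- The Jacobian matrix of `residues x`. -/
def residuesJacobian (x y : Fin N → ℝ) : Matrix (Fin N) (Fin N) ℝ :=
  Matrix.of fun i j => (∏ l ∈ Finset.univ.erase i, (x i - x l))⁻¹ *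
    ∏ l ∈ Finset.univ.erase j, (x i - y l)

lemma hasFDerivAt_residues (x y : Fin N → ℝ) : HasFDerivAt (residues x)
    (LinearMap.toContinuousLinearMap (Matrix.toLin' (residuesJacobian x y))) y := by
  rw [hasFDerivAt_pi']
  intro i
  have h1 : ∀ j ∈ (Finset.univ : Finset (Fin N)), HasFDerivAt (fun y : Fin N → ℝ => x i - y j)
      (-(ContinuousLinearMap.proj (R := ℝ) (φ := fun _ : Fin N => ℝ) j)) y := fun j _ =>
    (hasFDerivAt_apply j y).const_sub (x i)
  have h2 := ((HasFDerivAt.finsetProd h1).mul_const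
    ((∏ j ∈ Finset.univ.erase i, (x i - x j))⁻¹)).neg
  refine HasFDerivAt.congr_fderiv (f := fun y => residues x y i) h2 ?_
  refine ContinuousLinearMap.ext fun v => ?_
  simp [Matrix.toLin'_apply, Matrix.mulVec, dotProduct, residuesJacobian, Finset.mul_sum,
    mul_assoc]

/-- The absolute value of the Vandermonde determinant. -/
def absVandermonde (x : Fin N → ℝ) : ℝ := |(Matrix.vandermonde x).det|

lemma absVandermonde_pos {x : Fin N → ℝ} (hx : Function.Injective x) : 0 < absVandermonde x :=
  abs_pos.2 (Matrix.det_vandermonde_ne_zero_iff.2 hx)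

lemma vandermonde_mul_coeff (x : Fin N → ℝ) (p : Fin N → ℝ[X]) (hp : ∀ j, (p j).natDegree < N) :
    Matrix.vandermonde x * Matrix.of (fun i j : Fin N => (p j).coeff i) =
      Matrix.of fun i j => (p j).eval (x i) := by
  ext i j
  rw [Matrix.mul_apply, Matrix.of_apply, eval_eq_sum_range' (hp j),
    ← Fin.sum_univ_eq_sum_range (fun l => (p j).coeff l * x i ^ l)]
  exact Finset.sum_congr rfl fun l _ => mul_comm _ _

lemma prod_prod_erase_sub_eq (y : Fin N → ℝ) :
    |∏ j, ∏ l ∈ Finset.univ.erase j, (y j - y l)| = absVandermonde y ^ 2 := by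
  have h1 : ∀ j : Fin N, ∏ l ∈ Finset.univ.erase j, (y j - y l) =
      (∏ l ∈ Finset.Ioi j, (y j - y l)) * ∏ l ∈ Finset.Iio j, (y j - y l) := by
    intro j
    rw [← Finset.prod_union (Finset.disjoint_left.2 fun l h1 h2 =>
      lt_asymm (Finset.mem_Ioi.1 h1) (Finset.mem_Iio.1 h2))]
    congr 1
    ext l
    simp only [Finset.mem_erase, Finset.mem_univ, and_true, Finset.mem_union, Finset.mem_Ioi,
      Finset.mem_Iio]
    exact ⟨fun h => (lt_or_gt_of_ne h).symm, fun h => h.elim (fun h => h.ne') fun h => h.ne⟩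
  have h2 : ∏ j : Fin N, ∏ l ∈ Finset.Iio j, (y j - y l) =
      ∏ l : Fin N, ∏ j ∈ Finset.Ioi l, (y j - y l) :=
    Finset.prod_comm' (by simp)
  have h3 : |∏ j : Fin N, ∏ l ∈ Finset.Ioi j, (y j - y l)| = absVandermonde y := by
    rw [absVandermonde, Matrix.det_vandermonde]
    simp only [Finset.abs_prod]
    exact Finset.prod_congr rfl fun j _ => Finset.prod_congr rfl fun l _ => abs_sub_comm _ _
  simp only [h1, Finset.prod_mul_distrib, h2, abs_mul, h3]
  rw [← Matrix.det_vandermonde, ← absVandermonde, sq]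

/-- A Cauchy-type determinant. With `A` the coefficient matrix of `p j = ∏_{l ≠ j} (X - y l)`, the
Jacobian is a diagonal matrix times `V(x) A`. Evaluating at `y` instead makes `V(y) A` diagonal with
determinant `± Δ(y)²`, so `|det A| = Δ(y)`; the diagonal factor contributes `Δ(x)⁻²`. -/
lemma abs_det_residuesJacobian {x y : Fin N → ℝ} (hx : Function.Injective x)
    (hy : Function.Injective y) :
    |(residuesJacobian x y).det| = absVandermonde y / absVandermonde x := by
  let p : Fin N → ℝ[X] := fun j => ∏ l ∈ Finset.univ.erase j, (X - C (y l))
  have hp : ∀ j, (p j).natDegree < N := fun j => by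
    rw [natDegree_finsetProd_X_sub_C_eq_card, Finset.card_erase_of_mem (Finset.mem_univ j)]
    have := j.2
    simp
    omega
  set A : Matrix (Fin N) (Fin N) ℝ := Matrix.of fun i j => (p j).coeff i with hA
  have hpe : ∀ j z, (p j).eval z = ∏ l ∈ Finset.univ.erase j, (z - y l) := fun j z => by
    simp [p, eval_prod]
  have hyA : Matrix.vandermonde y * A =
      Matrix.diagonal fun j => ∏ l ∈ Finset.univ.erase j, (y j - y l) := by
    rw [vandermonde_mul_coeff y p hp]
    ext i j
    rw [Matrix.of_apply, hpe, Matrix.diagonal_apply]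
    split_ifs with h
    · rw [h]
    · exact Finset.prod_eq_zero (Finset.mem_erase.2 ⟨h, Finset.mem_univ i⟩) (sub_self _)
  have hJ : residuesJacobian x y =
      Matrix.diagonal (fun i => (∏ l ∈ Finset.univ.erase i, (x i - x l))⁻¹) *
        (Matrix.vandermonde x * A) := by
    rw [vandermonde_mul_coeff x p hp]
    ext i j
    rw [Matrix.diagonal_mul, Matrix.of_apply, hpe]
    rfl
  have h1 := congrArg (fun M => |M.det|) hyA
  simp only [Matrix.det_mul, abs_mul, Matrix.det_diagonal, prod_prod_erase_sub_eq] at h1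
  have hy0 := absVandermonde_pos hy
  have hx0 := absVandermonde_pos hx
  have h2 : |A.det| = absVandermonde y := by
    rw [← absVandermonde, sq] at h1
    exact mul_left_cancel₀ hy0.ne' h1
  rw [hJ, Matrix.det_mul, Matrix.det_mul, Matrix.det_diagonal, Finset.prod_inv_distrib, abs_mul,
    abs_inv, prod_prod_erase_sub_eq, abs_mul, h2, ← absVandermonde]
  field_simp

lemma measurableSet_strictInterlace (x : Fin N → ℝ) : MeasurableSet (strictInterlace x) := by
  unfold strictInterlace
  refine MeasurableSet.inter (s₁ := {y : Fin N → ℝ | ∀ i, x i < y i})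
    (s₂ := {y : Fin N → ℝ | ∀ i j : Fin N, (i : ℕ) + 1 = j → y i < x j}) ?_ ?_
  · simp only [Set.ofPred_forall]
    exact MeasurableSet.iInter fun i => measurableSet_lt (by fun_prop) (by fun_prop)
  · simp only [Set.ofPred_forall]
    exact MeasurableSet.iInter fun i => MeasurableSet.iInter fun j =>
      MeasurableSet.iInter fun _ => measurableSet_lt (by fun_prop) (by fun_prop)

lemma lintegral_pos_eq_strictInterlace {x : Fin N → ℝ} (hx : StrictMono x)
    (h : (Fin N → ℝ) → ℝ≥0∞) :
    ∫⁻ r in {r : Fin N → ℝ | ∀ i, 0 < r i}, h r =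
      ∫⁻ y in strictInterlace x, ENNReal.ofReal (absVandermonde y / absVandermonde x) *
        h (residues x y) := by
  rw [← residues_image hx, lintegral_image_eq_lintegral_abs_det_fderiv_mul volume
    (measurableSet_strictInterlace x)
    (fun y _ => (hasFDerivAt_residues x y).hasFDerivWithinAt) (residues_injOn hx)]
  refine setLIntegral_congr_fun (measurableSet_strictInterlace x) fun y hy => ?_
  rw [ContinuousLinearMap.det]
  simp only [LinearMap.coe_toContinuousLinearMap, LinearMap.det_toLin']
  rw [abs_det_residuesJacobian hx.injective (strictInterlace.strictMono hx hy).injective]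

/-- The two notions differ only on the null hyperplanes `y i = x j`. -/
lemma weakInterlace_ae_iff {x : Fin N → ℝ} :
    ∀ᵐ y : Fin N → ℝ, y ∈ strictInterlace x ↔ WeakInterlace x y := by
  have h : ∀ᵐ y : Fin N → ℝ, ∀ i j, y i ≠ x j := by
    rw [ae_all_iff]
    intro i
    rw [ae_all_iff]
    intro j
    have : (volume : Measure (Fin N → ℝ)) {y | y i = x j} = 0 :=
      Measure.pi_hyperplane (fun _ : Fin N => (volume : Measure ℝ)) i (x j)
    simpa [ae_iff] using this
  filter_upwards [h] with y hy
  exact ⟨fun h => ⟨fun i => (h.1 i).le, fun i j hij => (h.2 i j hij).le⟩,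
    fun h => ⟨fun i => lt_of_le_of_ne (h.1 i) (hy i i).symm,
      fun i j hij => lt_of_le_of_ne (h.2 i j hij) (hy i j)⟩⟩

lemma ae_injective : ∀ᵐ y : Fin N → ℝ, Function.Injective y := by
  have h : ∀ i j : Fin N, i ≠ j → ∀ᵐ y : Fin N → ℝ, y i ≠ y j := by
    intro i j hij
    let φ : (Fin N → ℝ) →ₗ[ℝ] ℝ :=
      LinearMap.proj (R := ℝ) (φ := fun _ : Fin N => ℝ) i - LinearMap.proj j
    have hφ : LinearMap.ker φ ≠ ⊤ := by
      intro h
      have : φ (Pi.single i 1) = 0 := by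
        have : Pi.single i 1 ∈ LinearMap.ker φ := h ▸ Submodule.mem_top
        exact this
      simp [φ, hij] at this
    have h0 := Measure.addHaar_submodule (volume : Measure (Fin N → ℝ)) _ hφ
    rw [ae_iff]
    refine measure_mono_null (fun y hy => ?_) h0
    have : y i = y j := by simpa using hy
    simp [φ, this]
  have h' : ∀ᵐ y : Fin N → ℝ, ∀ i j : Fin N, i ≠ j → y i ≠ y j := by
    rw [ae_all_iff]
    intro i
    rw [ae_all_iff]
    intro j
    by_cases hij : i = j
    · simp [hij]
    · filter_upwards [h i j hij] with y hy _ using hy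
  filter_upwards [h'] with y hy i j hij
  by_contra hne
  exact hy i j hne hij

end LaguerreField

end

noncomputable section

namespace LaguerreField

open Polynomial

variable {N : ℕ}

/-! ### Ordered eigenvalues -/

lemma orderedEigenvalues_monotone {M : Matrix (Fin N) (Fin N) ℂ} (hM : M.IsHermitian) :
    Monotone (orderedEigenvalues hM) := by
  intro i j hij
  refine hM.eigenvalues₀_antitone ?_
  simpa [Fin.le_def] using Fin.rev_le_rev.2 hij

lemma rootPoly_orderedEigenvalues {M : Matrix (Fin N) (Fin N) ℂ} (hM : M.IsHermitian) :
    rootPoly (Complex.ofReal ∘ orderedEigenvalues hM) = M.charpoly := by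
  have h := hM.roots_charpoly_eq_eigenvalues₀
  have hs : M.charpoly = (M.charpoly.roots.map fun a => X - C a).prod := by
    refine (prod_multiset_X_sub_C_of_monic_of_roots_card_eq M.charpoly_monic ?_).symm
    rw [h, M.charpoly_natDegree_eq_dim]
    simp
  rw [hs, h, Multiset.map_map, rootPoly]
  let e : Fin N ≃ Fin (Fintype.card (Fin N)) :=
    Fin.revPerm.trans (finCongr (Fintype.card_fin N).symm)
  exact Fintype.prod_equiv e _ _ fun i => rfl

lemma orderedEigenvalues_eq_iff {M : Matrix (Fin N) (Fin N) ℂ} (hM : M.IsHermitian)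
    {y : Fin N → ℝ} (hy : Monotone y) :
    orderedEigenvalues hM = y ↔ M.charpoly = rootPoly (Complex.ofReal ∘ y) := by
  rw [← rootPoly_orderedEigenvalues hM]
  exact ⟨fun h => by rw [h],
    eq_of_rootPoly_eq Complex.ofReal_injective (orderedEigenvalues_monotone hM) hy⟩

lemma orderedEigenvalues_congr {M M' : Matrix (Fin N) (Fin N) ℂ} (hM : M.IsHermitian)
    (hM' : M'.IsHermitian) (h : M.charpoly = M'.charpoly) :
    orderedEigenvalues hM = orderedEigenvalues hM' := by
  rw [orderedEigenvalues_eq_iff hM (orderedEigenvalues_monotone hM'), h,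
    rootPoly_orderedEigenvalues]

lemma isHermitian_vecMulVec_star (v : Fin N → ℂ) : (Matrix.vecMulVec v (star v)).IsHermitian := by
  rw [Matrix.IsHermitian, Matrix.conjTranspose_vecMulVec, star_star]

lemma isHermitian_diagonal_ofReal (x : Fin N → ℝ) :
    (Matrix.diagonal (Complex.ofReal ∘ x)).IsHermitian := by
  rw [Matrix.isHermitian_diagonal_iff]
  intro i
  simp [IsSelfAdjoint]

/-- The matrix determinant lemma gives equality at every `z` distinct from all `x i`, which is
infinitely many points. -/
lemma charpoly_diagonal_add_vecMulVec {K : Type*} [Field K] [Infinite K] (x v w : Fin N → K) :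
    (Matrix.diagonal x + Matrix.vecMulVec v w).charpoly = secularPoly x (fun i => v i * w i) := by
  refine eq_of_infinite_eval_eq _ _ ?_
  have hfin : (Set.range x).Finite := Set.finite_range x
  refine hfin.infinite_compl.mono fun z hz => ?_
  have hz' : ∀ i, z - x i ≠ 0 := fun i h => hz ⟨i, (sub_eq_zero.1 h).symm⟩
  change eval z _ = eval z _
  rw [secularPoly_eval, Matrix.eval_charpoly]
  have hdet : (Matrix.diagonal fun i => z - x i).det = ∏ i, (z - x i) := Matrix.det_diagonal
  have hunit : IsUnit (Matrix.diagonal fun i => z - x i).det := by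
    rw [hdet, isUnit_iff_ne_zero]
    exact Finset.prod_ne_zero_iff.2 fun i _ => hz' i
  have hM : Matrix.scalar (Fin N) z - (Matrix.diagonal x + Matrix.vecMulVec v w) =
      Matrix.diagonal (fun i => z - x i) +
        Matrix.replicateCol Unit (-v) * Matrix.replicateRow Unit w := by
    ext i j
    by_cases h : i = j
    · subst h
      simp [Matrix.mul_apply, Matrix.vecMulVec_apply]
      ring
    · simp [Matrix.mul_apply, Matrix.vecMulVec_apply, h]
  have hinv : (Matrix.diagonal fun i => z - x i)⁻¹ = Matrix.diagonal fun i => (z - x i)⁻¹ := by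
    refine Matrix.inv_eq_right_inv ?_
    rw [Matrix.diagonal_mul_diagonal, ← Matrix.diagonal_one]
    congr 1
    ext i
    exact mul_inv_cancel₀ (hz' i)
  rw [hM, Matrix.det_add_replicateCol_mul_replicateRow hunit, hdet, hinv, Matrix.det_unique]
  have h1 : ((1 : Matrix Unit Unit K) + Matrix.replicateRow Unit w * Matrix.diagonal (fun i => (z - x i)⁻¹) *
      Matrix.replicateCol Unit (-v)) default default =
      1 - ∑ i, v i * w i * (z - x i)⁻¹ := by
    simp [Matrix.mul_apply, Matrix.diagonal_apply, sub_eq_add_neg]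
    exact Finset.sum_congr rfl fun i _ => by ring
  rw [h1, mul_sub, mul_one, Finset.mul_sum]
  congr 1
  refine Finset.sum_congr rfl fun i _ => ?_
  rw [← Finset.mul_prod_erase _ _ (Finset.mem_univ i)]
  field_simp [hz' i]

lemma map_secularPoly (x r : Fin N → ℝ) : (secularPoly x r).map Complex.ofRealHom =
    secularPoly (Complex.ofReal ∘ x) (Complex.ofReal ∘ r) := by
  simp [secularPoly, rootPoly, Polynomial.map_prod, Polynomial.map_sum]

lemma map_rootPoly (x : Fin N → ℝ) : (rootPoly x).map Complex.ofRealHom =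
    rootPoly (Complex.ofReal ∘ x) := by
  simp [rootPoly, Polynomial.map_prod]

lemma orderedEigenvalues_diagonal_add {x y : Fin N → ℝ} (hx : StrictMono x)
    (hy : y ∈ strictInterlace x) {v : Fin N → ℂ}
    (hv : ∀ i, Complex.normSq (v i) = residues x y i)
    (hM : (Matrix.diagonal (Complex.ofReal ∘ x) + Matrix.vecMulVec v (star v)).IsHermitian) :
    orderedEigenvalues hM = y := by
  rw [orderedEigenvalues_eq_iff hM (strictInterlace.strictMono hx hy).monotone,
    charpoly_diagonal_add_vecMulVec, ← map_rootPoly,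
    rootPoly_eq_secularPoly_residues hx.injective, map_secularPoly]
  congr 1
  ext i
  simp [← hv, Complex.mul_conj]

/-- `U` is the adjoint of the eigenvector matrix, its rows permuted to put the eigenvalues in
increasing order. It depends on `M` alone, so it can be applied to a random `v`. -/
lemma exists_unitary_charpoly_add {M : Matrix (Fin N) (Fin N) ℂ} (hM : M.IsHermitian) :
    ∃ U ∈ Matrix.unitaryGroup (Fin N) ℂ, ∀ v : Fin N → ℂ,
      (M + Matrix.vecMulVec v (star v)).charpoly =
        (Matrix.diagonal (Complex.ofReal ∘ orderedEigenvalues hM) +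
          Matrix.vecMulVec (U *ᵥ v) (star (U *ᵥ v))).charpoly := by
  let σ : Fin N ≃ Fin N := (Fin.revPerm.trans (finCongr (Fintype.card_fin N).symm)).trans
    (Fintype.equivOfCardEq (Fintype.card_fin _))
  have hσ : ∀ j, orderedEigenvalues hM j = hM.eigenvalues (σ j) := by
    intro j
    simp [orderedEigenvalues, Matrix.IsHermitian.eigenvalues, σ]
  set W : Matrix (Fin N) (Fin N) ℂ := (hM.eigenvectorUnitary : Matrix (Fin N) (Fin N) ℂ) with hW
  have hWs : star W * W = 1 := Unitary.coe_star_mul_self hM.eigenvectorUnitary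
  have hWs' : W * star W = 1 := Unitary.coe_mul_star_self hM.eigenvectorUnitary
  refine ⟨(star W).submatrix σ id, ?_, fun v => ?_⟩
  · have hstar : star ((star W).submatrix σ id) = W.submatrix id σ := by
      ext i j
      simp [Matrix.star_apply]
    rw [Matrix.mem_unitaryGroup_iff, hstar]
    rw [show (id : Fin N → Fin N) = Equiv.refl (Fin N) from rfl, Matrix.submatrix_mul_equiv, hWs]
    exact Matrix.submatrix_one_equiv σ
  · have hsp := hM.spectral_theorem
    rw [Unitary.conjStarAlgAut_apply, ← hW] at hsp
    have h1 : M + Matrix.vecMulVec v (star v) =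
        W * (Matrix.diagonal (RCLike.ofReal ∘ hM.eigenvalues) +
          Matrix.vecMulVec (star W *ᵥ v) (star (star W *ᵥ v))) * star W := by
      rw [Matrix.mul_add, Matrix.add_mul, ← hsp, Matrix.mul_vecMulVec, Matrix.vecMulVec_mul,
        Matrix.mulVec_mulVec, hWs', Matrix.one_mulVec, Matrix.star_mulVec,
        ← Matrix.star_eq_conjTranspose, star_star, Matrix.vecMul_vecMul, hWs',
        Matrix.vecMul_one]
    have h2 : (Matrix.diagonal (Complex.ofReal ∘ orderedEigenvalues hM) +
          Matrix.vecMulVec ((star W).submatrix σ id *ᵥ v)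
            (star ((star W).submatrix σ id *ᵥ v))) =
        Matrix.reindex σ.symm σ.symm (Matrix.diagonal (RCLike.ofReal ∘ hM.eigenvalues) +
          Matrix.vecMulVec (star W *ᵥ v) (star (star W *ᵥ v))) := by
      ext i j
      simp only [Matrix.reindex_apply, Equiv.symm_symm, Matrix.submatrix_apply, Matrix.add_apply,
        Matrix.diagonal_apply, Matrix.vecMulVec_apply, Function.comp_apply, hσ,
        σ.injective.eq_iff]
      rfl
    rw [h2, Matrix.charpoly_reindex, h1, Matrix.charpoly_mul_comm, ← mul_assoc, hWs, one_mul]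

/-- A new row `a` contributes `aᴴ a`, with the conjugate on the left. Transposing keeps the
characteristic polynomial and lets `U` act on `a` itself. -/
lemma exists_unitary_charpoly_add_star {M : Matrix (Fin N) (Fin N) ℂ} (hM : M.IsHermitian) :
    ∃ U ∈ Matrix.unitaryGroup (Fin N) ℂ, ∀ a : Fin N → ℂ,
      (M + Matrix.vecMulVec (star a) a).charpoly =
        (Matrix.diagonal (Complex.ofReal ∘ orderedEigenvalues hM) +
          Matrix.vecMulVec (U *ᵥ a) (star (U *ᵥ a))).charpoly := by
  obtain ⟨U, hU, h⟩ := exists_unitary_charpoly_add hM.transpose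
  refine ⟨U, hU, fun a => ?_⟩
  rw [orderedEigenvalues_congr hM hM.transpose M.charpoly_transpose.symm, ← h,
    ← Matrix.charpoly_transpose (M + _), Matrix.transpose_add, Matrix.transpose_vecMulVec]

end LaguerreField

end

noncomputable section

namespace LaguerreField

open Real

variable {N : ℕ}

/-! ### Complex Gaussian vectors -/

/-- The complex number with real part `p.1 / √2` and imaginary part `p.2 / √2`. -/
def toComplex (p : ℝ × ℝ) : ℂ := ((p.1 / √2 : ℝ) : ℂ) + Complex.I * ((p.2 / √2 : ℝ) : ℂ)

lemma measurable_toComplex : Measurable toComplex := by unfold toComplex; fun_prop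

lemma toComplex_re (p : ℝ × ℝ) : (toComplex p).re = p.1 / √2 := by simp [toComplex]

lemma toComplex_im (p : ℝ × ℝ) : (toComplex p).im = p.2 / √2 := by simp [toComplex]

lemma normSq_toComplex (p : ℝ × ℝ) : Complex.normSq (toComplex p) = (p.1 ^ 2 + p.2 ^ 2) / 2 := by
  rw [Complex.normSq_apply, toComplex_re, toComplex_im]
  have : √2 * √2 = (2 : ℝ) := Real.mul_self_sqrt zero_le_two
  field_simp
  rw [sq (√2), this]
  ring

/-- The law of `complexBM` at time `t`. -/
def complexGaussian (t : ℝ≥0) : Measure ℂ :=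
  ((gaussianReal 0 t).prod (gaussianReal 0 t)).map toComplex

instance (t : ℝ≥0) : IsProbabilityMeasure (complexGaussian t) :=
  Measure.isProbabilityMeasure_map measurable_toComplex.aemeasurable

/-- The law of a row of `matA` at time `t`. -/
def rowLaw (N : ℕ) (t : ℝ≥0) : Measure (Fin N → ℂ) := Measure.pi fun _ => complexGaussian t

instance (t : ℝ≥0) : IsProbabilityMeasure (rowLaw N t) := by unfold rowLaw; infer_instance

lemma charFun_complexGaussian (t : ℝ≥0) (z : ℂ) :
    charFun (complexGaussian t) z = Complex.exp (-(t * ‖z‖ ^ 2 / 4 : ℝ)) := by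
  have h : ∀ p : ℝ × ℝ, Complex.exp ((inner ℝ (toComplex p) z : ℝ) * Complex.I) =
      Complex.exp ((inner ℝ p.1 (z.re / √2) : ℝ) * Complex.I) *
        Complex.exp ((inner ℝ p.2 (z.im / √2) : ℝ) * Complex.I) := by
    intro p
    rw [← Complex.exp_add, ← add_mul, ← Complex.ofReal_add]
    congr 3
    rw [Complex.inner, Complex.mul_re, Complex.conj_re, Complex.conj_im, toComplex_re,
      toComplex_im]
    simp
    ring
  rw [charFun_apply, complexGaussian, integral_map measurable_toComplex.aemeasurable
    (by fun_prop)]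
  simp only [h]
  rw [integral_prod_mul (fun x : ℝ => Complex.exp ((inner ℝ x (z.re / √2) : ℝ) * Complex.I))
    (fun x : ℝ => Complex.exp ((inner ℝ x (z.im / √2) : ℝ) * Complex.I)), ← charFun_apply,
    ← charFun_apply, charFun_gaussianReal, charFun_gaussianReal, ← Complex.exp_add,
    ← Complex.normSq_eq_norm_sq, Complex.normSq_apply]
  congr 1
  have : (√2 : ℂ) ^ 2 = 2 := by
    rw [← Complex.ofReal_pow, Real.sq_sqrt zero_le_two]
    norm_num
  push_cast
  rw [div_pow, div_pow, this]
  ring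

/-- Only the norm of `z` enters, which is the source of unitary invariance. -/
lemma charFun_rowLaw (t : ℝ≥0) (z : EuclideanSpace ℂ (Fin N)) :
    charFun ((rowLaw N t).map (WithLp.toLp 2)) z = Complex.exp (-(t * ‖z‖ ^ 2 / 4 : ℝ)) := by
  rw [rowLaw, charFun_pi]
  simp only [charFun_complexGaussian]
  rw [← Complex.exp_sum]
  congr 1
  rw [EuclideanSpace.norm_sq_eq]
  push_cast
  rw [Finset.sum_neg_distrib, Finset.mul_sum, Finset.sum_div]

lemma real_inner_eq_re_dotProduct (u v : EuclideanSpace ℂ (Fin N)) :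
    inner ℝ u v = (star u.ofLp ⬝ᵥ v.ofLp).re := by
  simp [PiLp.inner_apply, Complex.inner, dotProduct, mul_comm]

lemma rowLaw_map_unitary (t : ℝ≥0) {U : Matrix (Fin N) (Fin N) ℂ}
    (hU : U ∈ Matrix.unitaryGroup (Fin N) ℂ) :
    (rowLaw N t).map (fun a => U *ᵥ a) = rowLaw N t := by
  have hm : Measurable fun a : Fin N → ℂ => U *ᵥ a := by
    unfold Matrix.mulVec dotProduct
    fun_prop
  have hto : Measurable (WithLp.toLp 2 : (Fin N → ℂ) → EuclideanSpace ℂ (Fin N)) :=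
    WithLp.measurable_toLp 2 _
  have hof : Measurable (WithLp.ofLp : EuclideanSpace ℂ (Fin N) → (Fin N → ℂ)) :=
    WithLp.measurable_ofLp 2 _
  -- `Fin N → ℂ` carries the sup norm, so characteristic functions are compared on the Euclidean
  -- space. There the adjoint of `U` moves onto `z` and preserves its norm.
  have key : ((rowLaw N t).map (fun a => U *ᵥ a)).map
      (WithLp.toLp 2 : (Fin N → ℂ) → EuclideanSpace ℂ (Fin N)) =
      (rowLaw N t).map (WithLp.toLp 2) := by
    have : IsProbabilityMeasure ((rowLaw N t).map (fun a => U *ᵥ a)) :=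
      Measure.isProbabilityMeasure_map hm.aemeasurable
    refine Measure.ext_of_charFun ?_
    ext z
    have hinner : ∀ a : Fin N → ℂ, inner ℝ (WithLp.toLp 2 (U *ᵥ a)) z =
        inner ℝ (WithLp.toLp 2 a : EuclideanSpace ℂ (Fin N)) (WithLp.toLp 2 (star U *ᵥ z.ofLp)) := by
      intro a
      rw [real_inner_eq_re_dotProduct, real_inner_eq_re_dotProduct, Matrix.star_mulVec,
        ← Matrix.dotProduct_mulVec, Matrix.star_eq_conjTranspose]
    have hnorm : ‖(WithLp.toLp 2 (star U *ᵥ z.ofLp) : EuclideanSpace ℂ (Fin N))‖ = ‖z‖ := by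
      rw [← sq_eq_sq₀ (norm_nonneg _) (norm_nonneg _), ← real_inner_self_eq_norm_sq,
        ← real_inner_self_eq_norm_sq, real_inner_eq_re_dotProduct, real_inner_eq_re_dotProduct,
        Matrix.star_mulVec, ← Matrix.dotProduct_mulVec, Matrix.mulVec_mulVec,
        Matrix.star_eq_conjTranspose, Matrix.conjTranspose_conjTranspose,
        ← Matrix.star_eq_conjTranspose, Matrix.mem_unitaryGroup_iff.1 hU, Matrix.one_mulVec]
    rw [charFun_apply, integral_map hto.aemeasurable (by fun_prop),
      integral_map hm.aemeasurable (by fun_prop)]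
    simp only [hinner]
    rw [charFun_rowLaw, ← hnorm, ← charFun_rowLaw, charFun_apply,
      integral_map hto.aemeasurable (by fun_prop)]
  have h2 := congrArg (fun μ => μ.map (WithLp.ofLp : EuclideanSpace ℂ (Fin N) → (Fin N → ℂ))) key
  simp only [Measure.map_map hof hto] at h2
  simpa [Function.comp_def] using h2

/-! ### Squared moduli of complex Gaussians -/

lemma lintegral_pi_prod {n : ℕ} (μ : Fin n → Measure ℝ) [∀ i, SigmaFinite (μ i)]
    {f : Fin n → ℝ → ℝ≥0∞} (hf : ∀ i, Measurable (f i)) :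
    ∫⁻ x, ∏ i, f i (x i) ∂Measure.pi μ = ∏ i, ∫⁻ x, f i x ∂μ i := by
  induction n with
  | zero => simp
  | succ n ih =>
    have h := (measurePreserving_piFinSuccAbove μ 0).symm
    rw [← h.lintegral_comp (by fun_prop)]
    have : ∀ p : ℝ × (Fin n → ℝ), ∏ i, f i ((MeasurableEquiv.piFinSuccAbove
        (fun _ => ℝ) 0).symm p i) = f 0 p.1 * ∏ i : Fin n, f i.succ (p.2 i) := by
      intro p
      rw [Fin.prod_univ_succ]
      simp [MeasurableEquiv.piFinSuccAbove]
    simp only [this]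
    rw [lintegral_prod_mul (f := f 0) (g := fun y : Fin n → ℝ => ∏ i : Fin n, f i.succ (y i))
      (hf 0).aemeasurable (Finset.measurable_prod _ fun i _ =>
        (hf i.succ).comp (measurable_pi_apply i)).aemeasurable, Fin.prod_univ_succ]
    congr 1
    simpa using ih (fun i => μ i.succ) (fun i => hf i.succ)

lemma pi_withDensity {n : ℕ} {f : Fin n → ℝ → ℝ≥0∞} (hf : ∀ i, Measurable (f i))
    [∀ i, SigmaFinite ((volume : Measure ℝ).withDensity (f i))] :
    Measure.pi (fun i => (volume : Measure ℝ).withDensity (f i)) =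
      (volume : Measure (Fin n → ℝ)).withDensity fun x => ∏ i, f i (x i) := by
  refine Measure.pi_eq fun s hs => ?_
  rw [withDensity_apply _ (MeasurableSet.univ_pi hs), ← lintegral_indicator (MeasurableSet.univ_pi hs)]
  have h1 : (Set.univ.pi s).indicator (fun x : Fin n → ℝ => ∏ i, f i (x i)) =
      fun x => ∏ i, (s i).indicator (f i) (x i) := by
    ext x
    by_cases hx : x ∈ Set.univ.pi s
    · rw [Set.indicator_of_mem hx]
      exact Finset.prod_congr rfl fun i _ => (Set.indicator_of_mem (hx i trivial) _).symm
    · rw [Set.indicator_of_notMem hx]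
      obtain ⟨i, hi⟩ : ∃ i, x i ∉ s i := by simpa using hx
      exact (Finset.prod_eq_zero (Finset.mem_univ i) (Set.indicator_of_notMem hi _)).symm
  rw [h1, volume_pi, lintegral_pi_prod _ fun i => (hf i).indicator (hs i)]
  refine Finset.prod_congr rfl fun i _ => ?_
  rw [lintegral_indicator (hs i), withDensity_apply _ (hs i)]

/-- The density of the exponential law with mean `t`. -/
def expDensity (t : ℝ≥0) (s : ℝ) : ℝ≥0∞ :=
  (Set.Ioi (0 : ℝ)).indicator (fun s => ENNReal.ofReal (exp (-s / t) / t)) s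

lemma measurable_expDensity (t : ℝ≥0) : Measurable (expDensity t) := by
  refine Measurable.indicator ?_ measurableSet_Ioi
  fun_prop

/-- In polar coordinates the substitution `s = r² / 2` absorbs the Jacobian `r dr`, and the angle
contributes `2π`. -/
lemma lintegral_radial {F : ℝ → ℝ≥0∞} (hF : Measurable F) :
    ∫⁻ p : ℝ × ℝ, F ((p.1 ^ 2 + p.2 ^ 2) / 2) =
      ENNReal.ofReal (2 * π) * ∫⁻ s in Set.Ioi (0 : ℝ), F s := by
  have h1 : ∀ p : ℝ × ℝ, ENNReal.ofReal p.1 •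
      F (((polarCoord.symm p).1 ^ 2 + (polarCoord.symm p).2 ^ 2) / 2) =
      ENNReal.ofReal p.1 * F (p.1 ^ 2 / 2) * 1 := by
    intro p
    rw [polarCoord_symm_apply, smul_eq_mul, mul_one]
    congr 2
    dsimp only
    linear_combination p.1 ^ 2 / 2 * Real.sin_sq_add_cos_sq p.2
  have himage : (fun r : ℝ => r ^ 2 / 2) '' Set.Ioi 0 = Set.Ioi 0 := by
    ext s
    simp only [Set.mem_image, Set.mem_Ioi]
    constructor
    · rintro ⟨r, hr, rfl⟩
      positivity
    · intro hs
      refine ⟨√(2 * s), by positivity, ?_⟩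
      rw [Real.sq_sqrt (by positivity)]
      ring
  have hsub : ∫⁻ s in Set.Ioi (0 : ℝ), F s =
      ∫⁻ r in Set.Ioi (0 : ℝ), ENNReal.ofReal r * F (r ^ 2 / 2) := by
    rw [← himage, lintegral_image_eq_lintegral_abs_deriv_mul measurableSet_Ioi
      (f' := fun r => r) (fun r _ => ?_) (fun r hr r' hr' h => ?_), himage]
    · refine setLIntegral_congr_fun measurableSet_Ioi fun r hr => ?_
      rw [abs_of_pos (Set.mem_Ioi.1 hr)]
    · have := ((hasDerivAt_pow 2 r).div_const 2).hasDerivWithinAt (s := Set.Ioi 0)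
      refine this.congr_deriv ?_
      norm_num
    · have h' : r ^ 2 = r' ^ 2 := by linarith
      exact (sq_eq_sq₀ (le_of_lt hr) (le_of_lt hr')).1 h'
  rw [← lintegral_comp_polarCoord_symm]
  simp only [h1]
  rw [polarCoord_target, Measure.volume_eq_prod, ← Measure.prod_restrict,
    lintegral_prod_mul (f := fun r => ENNReal.ofReal r * F (r ^ 2 / 2)) (g := fun _ => 1)
      (by fun_prop) (by fun_prop), ← hsub, mul_comm]
  congr 1
  simp only [lintegral_const, Measure.restrict_apply_univ, Real.volume_Ioo, one_mul]
  congr 1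
  ring

lemma map_normSq_complexGaussian {t : ℝ≥0} (ht : 0 < t) :
    (complexGaussian t).map Complex.normSq = volume.withDensity (expDensity t) := by
  have hns : Measurable Complex.normSq := Complex.continuous_normSq.measurable
  have ht' : (0 : ℝ) < t := ht
  have hcomp : ∀ f : ℝ → ℝ≥0∞, Measurable f → Measurable fun z => f (Complex.normSq z) :=
    fun f hf => hf.comp hns
  refine Measure.ext_of_lintegral _ fun f hf => ?_
  rw [lintegral_map hf hns, complexGaussian, lintegral_map (hcomp f hf) measurable_toComplex,
    gaussianReal_of_var_ne_zero _ ht.ne', prod_withDensity (measurable_gaussianPDF _ _)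
      (measurable_gaussianPDF _ _), ← Measure.volume_eq_prod,
    lintegral_withDensity_eq_lintegral_mul _ (by fun_prop)
      (g := fun p => f (Complex.normSq (toComplex p)))
      ((hcomp f hf).comp measurable_toComplex),
    lintegral_withDensity_eq_lintegral_mul _ (measurable_expDensity t) hf]
  let F : ℝ → ℝ≥0∞ := fun s => ENNReal.ofReal (exp (-s / t) / (2 * π * t)) * f s
  have hF : Measurable F := by fun_prop
  have h1 : ∀ p : ℝ × ℝ, ((fun z : ℝ × ℝ => gaussianPDF 0 t z.1 * gaussianPDF 0 t z.2) *
      fun p => f (Complex.normSq (toComplex p))) p = F ((p.1 ^ 2 + p.2 ^ 2) / 2) := by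
    intro p
    simp only [Pi.mul_apply, F, normSq_toComplex]
    congr 1
    rw [gaussianPDF, gaussianPDF, ← ENNReal.ofReal_mul (gaussianPDFReal_nonneg _ _ _)]
    congr 1
    rw [gaussianPDFReal, gaussianPDFReal]
    have h2 : √(2 * π * t) * √(2 * π * t) = 2 * π * t := Real.mul_self_sqrt (by positivity)
    calc _ = (√(2 * π * t) * √(2 * π * t))⁻¹ *
          (exp (-(p.1 - 0) ^ 2 / (2 * t)) * exp (-(p.2 - 0) ^ 2 / (2 * t))) := by
          rw [mul_inv]; ring
      _ = _ := by
          have h3 : -(p.1 - 0) ^ 2 / (2 * (t : ℝ)) + -(p.2 - 0) ^ 2 / (2 * t) =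
              -((p.1 ^ 2 + p.2 ^ 2) / 2) / t := by
            field_simp
            ring
          rw [h2, ← Real.exp_add, h3]
          ring
  rw [lintegral_congr h1, lintegral_radial hF, ← lintegral_const_mul _ hF,
    ← lintegral_indicator measurableSet_Ioi]
  refine lintegral_congr fun s => ?_
  by_cases hs : s ∈ Set.Ioi (0 : ℝ)
  · simp only [Set.indicator_of_mem hs, F, Pi.mul_apply, expDensity]
    rw [← mul_assoc, ← ENNReal.ofReal_mul (by positivity)]
    congr 2
    field_simp
  · simp [Set.indicator_of_notMem hs, expDensity]

/-- The squared moduli are independent exponentials, so the density depends on `r` only through its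
sum, which `sum_residues` later turns into a difference of traces. -/
lemma lintegral_rowLaw_normSq {t : ℝ≥0} (ht : 0 < t) {h : (Fin N → ℝ) → ℝ≥0∞}
    (hh : Measurable h) :
    ∫⁻ a, h (fun i => Complex.normSq (a i)) ∂rowLaw N t =
      ∫⁻ r in {r : Fin N → ℝ | ∀ i, 0 < r i},
        ENNReal.ofReal ((t⁻¹ : ℝ) ^ N * exp (-(∑ i, r i) / t)) * h r := by
  have hns : Measurable Complex.normSq := Complex.continuous_normSq.measurable
  have hmap : Measurable fun a : Fin N → ℂ => fun i => Complex.normSq (a i) := by fun_prop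
  have hprob : IsProbabilityMeasure ((volume : Measure ℝ).withDensity (expDensity t)) := by
    rw [← map_normSq_complexGaussian ht]
    exact Measure.isProbabilityMeasure_map hns.aemeasurable
  have hS : MeasurableSet {r : Fin N → ℝ | ∀ i, 0 < r i} := by
    rw [Set.ofPred_forall]
    exact MeasurableSet.iInter fun i => measurableSet_lt (by fun_prop) (by fun_prop)
  have hlaw : (rowLaw N t).map (fun a i => Complex.normSq (a i)) =
      volume.withDensity fun r : Fin N → ℝ => ∏ i, expDensity t (r i) := by
    rw [rowLaw, Measure.pi_map_pi (fun _ => hns.aemeasurable)]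
    simp only [map_normSq_complexGaussian ht]
    exact pi_withDensity fun _ => measurable_expDensity t
  have hdens : Measurable fun r : Fin N → ℝ => ∏ i, expDensity t (r i) :=
    Finset.measurable_prod _ fun i _ => (measurable_expDensity t).comp (measurable_pi_apply i)
  rw [← lintegral_map hh hmap, hlaw, lintegral_withDensity_eq_lintegral_mul _ hdens hh,
    ← lintegral_indicator hS]
  refine lintegral_congr fun r => ?_
  by_cases hr : r ∈ {r : Fin N → ℝ | ∀ i, 0 < r i}
  · rw [Set.indicator_of_mem hr, Pi.mul_apply]
    congr 1
    have : ∀ i, expDensity t (r i) = ENNReal.ofReal (exp (-r i / t) / t) := fun i =>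
      Set.indicator_of_mem (Set.mem_Ioi.2 (hr i)) _
    simp only [this]
    rw [← ENNReal.ofReal_prod_of_nonneg fun i _ => by positivity]
    congr 1
    simp only [div_eq_mul_inv, Finset.prod_mul_distrib, ← Real.exp_sum, Finset.prod_const,
      Finset.card_fin, ← Finset.sum_mul, Finset.sum_neg_distrib]
    ring
  · rw [Set.indicator_of_notMem hr, Pi.mul_apply]
    obtain ⟨i, hi⟩ : ∃ i, ¬ 0 < r i := by simpa using hr
    rw [Finset.prod_eq_zero (Finset.mem_univ i) (Set.indicator_of_notMem hi _), zero_mul]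

end LaguerreField

end

noncomputable section

namespace LaguerreField

open Real

variable {N : ℕ}

/-! ### The law of the spectrum after a Gaussian rank one perturbation -/

open Classical in
/-- The ordered eigenvalues of a Hermitian matrix, and zero for other matrices. -/
def spec (M : Matrix (Fin N) (Fin N) ℂ) : Fin N → ℝ :=
  if h : M.IsHermitian then orderedEigenvalues h else 0

lemma spec_eq {M : Matrix (Fin N) (Fin N) ℂ} (h : M.IsHermitian) :
    spec M = orderedEigenvalues h := dif_pos h

lemma spec_congr {M M' : Matrix (Fin N) (Fin N) ℂ} (hM : M.IsHermitian)
    (hM' : M'.IsHermitian) (h : M.charpoly = M'.charpoly) : spec M = spec M' := by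
  rw [spec_eq hM, spec_eq hM', orderedEigenvalues_congr hM hM' h]

/-- The relation "`y` is ordered and lists the roots of the characteristic polynomial of `M e`" is
closed in `(e, y)`. Projecting along a compact piece of a closed set `K` is a closed map, so the
preimage of `K` is a countable union of closed sets. -/
lemma measurable_spec {E : Type*} [TopologicalSpace E] [MeasurableSpace E]
    [OpensMeasurableSpace E] {M : E → Matrix (Fin N) (Fin N) ℂ} (hM : Continuous M)
    (hH : ∀ e, (M e).IsHermitian) : Measurable fun e => spec (M e) := by
  refine measurable_of_isClosed fun K hK => ?_
  let Y : ℕ → Set (Fin N → ℝ) := fun n => K ∩ Metric.closedBall 0 n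
  have hY : ∀ n, IsCompact (Y n) := fun n => (isCompact_closedBall _ _).inter_left hK
  let S : ∀ n, Set (E × Y n) := fun n => {p | Monotone (p.2 : Fin N → ℝ) ∧
    ∀ z : ℂ, (Matrix.scalar (Fin N) z - M p.1).det = ∏ j, (z - ((p.2 : Fin N → ℝ) j : ℂ))}
  have hS : ∀ n, IsClosed (S n) := by
    intro n
    have hc : ∀ i, Continuous fun p : E × Y n => (p.2 : Fin N → ℝ) i := fun i =>
      (continuous_apply i).comp (continuous_subtype_val.comp continuous_snd)
    refine IsClosed.inter (s₁ := {p : E × Y n | Monotone (p.2 : Fin N → ℝ)})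
      (s₂ := {p : E × Y n | ∀ z : ℂ, (Matrix.scalar (Fin N) z - M p.1).det =
        ∏ j, (z - ((p.2 : Fin N → ℝ) j : ℂ))}) ?_ ?_
    · simp only [Monotone, Set.ofPred_forall]
      exact isClosed_iInter fun i => isClosed_iInter fun j => isClosed_iInter fun _ =>
        isClosed_le (hc i) (hc j)
    · simp only [Set.ofPred_forall]
      refine isClosed_iInter fun z => isClosed_eq ?_ (continuous_finsetProd _ fun j _ =>
        continuous_const.sub (Complex.continuous_ofReal.comp (hc j)))
      exact (continuous_const.sub (hM.comp continuous_fst)).matrix_det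
  have hpre : (fun e => spec (M e)) ⁻¹' K = ⋃ n, Prod.fst '' S n := by
    ext e
    simp only [Set.mem_preimage, Set.mem_iUnion, Set.mem_image]
    constructor
    · intro he
      obtain ⟨n, hn⟩ := exists_nat_ge ‖spec (M e)‖
      refine ⟨n, (e, ⟨spec (M e), he, by simpa using hn⟩), ⟨?_, fun z => ?_⟩, rfl⟩
      · change Monotone (spec (M e))
        rw [spec_eq (hH e)]
        exact orderedEigenvalues_monotone _
      · change _ = ∏ j, (z - (spec (M e) j : ℂ))
        rw [← Matrix.eval_charpoly, ← rootPoly_orderedEigenvalues (hH e), rootPoly_eval,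
          spec_eq (hH e)]
        rfl
    · rintro ⟨n, ⟨e', y, hy⟩, ⟨h1, h2⟩, rfl⟩
      have : spec (M e') = y := by
        rw [spec_eq (hH e'), orderedEigenvalues_eq_iff (hH e') h1]
        refine Polynomial.funext fun z => ?_
        rw [Matrix.eval_charpoly, rootPoly_eval]
        exact h2 z
      change spec (M e') ∈ K
      rw [this]
      exact hy.1
  rw [hpre]
  refine MeasurableSet.iUnion fun n => IsClosed.measurableSet ?_
  have : CompactSpace (Y n) := isCompact_iff_compactSpace.1 (hY n)
  exact isClosedMap_fst_of_compactSpace _ (hS n)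

lemma continuous_vecMulVec_star {E : Type*} [TopologicalSpace E] {v : E → Fin N → ℂ}
    (hv : Continuous v) : Continuous fun e => Matrix.vecMulVec (v e) (star (v e)) := by
  refine continuous_matrix fun i j => ?_
  simp only [Matrix.vecMulVec_apply, Pi.star_apply]
  fun_prop

/-- The `h`-transform weight of the transition density of the spectrum. -/
def weight (t : ℝ≥0) (x : Fin N → ℝ) : ℝ≥0∞ :=
  ENNReal.ofReal (absVandermonde x * exp (-(∑ i, x i) / t))

lemma continuous_absVandermonde : Continuous (absVandermonde (N := N)) := by
  unfold absVandermonde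
  refine (Continuous.matrix_det ?_).abs
  refine continuous_matrix fun i j => ?_
  simp only [Matrix.vandermonde_apply]
  fun_prop

lemma measurable_weight (t : ℝ≥0) : Measurable (weight (N := N) t) := by
  have := (continuous_absVandermonde (N := N)).measurable
  unfold weight
  fun_prop

lemma weight_ne_zero (t : ℝ≥0) {x : Fin N → ℝ} (hx : Function.Injective x) : weight t x ≠ 0 := by
  rw [weight, ENNReal.ofReal_ne_zero_iff]
  exact mul_pos (absVandermonde_pos hx) (exp_pos _)

/-- The secular polynomial does not see the phases of `v`. -/
lemma spec_diagonal_add_congr (x : Fin N → ℝ) {v w : Fin N → ℂ}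
    (h : ∀ i, Complex.normSq (v i) = Complex.normSq (w i)) :
    spec (Matrix.diagonal (Complex.ofReal ∘ x) + Matrix.vecMulVec v (star v)) =
      spec (Matrix.diagonal (Complex.ofReal ∘ x) + Matrix.vecMulVec w (star w)) := by
  refine spec_congr ((isHermitian_diagonal_ofReal x).add (isHermitian_vecMulVec_star v))
    ((isHermitian_diagonal_ofReal x).add (isHermitian_vecMulVec_star w)) ?_
  rw [charpoly_diagonal_add_vecMulVec, charpoly_diagonal_add_vecMulVec]
  congr 1
  ext i
  simp [Complex.mul_conj, h]

/-- The transition density. The exponential density at `residues x y` depends only on `∑ y - ∑ x`,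
so together with the Jacobian `Δ(y) / Δ(x)` it splits into `weight t y / weight t x`. -/
lemma lintegral_spec_add_rowLaw {t : ℝ≥0} (ht : 0 < t) {M : Matrix (Fin N) (Fin N) ℂ}
    (hM : M.IsHermitian) (hx : StrictMono (spec M)) {f : (Fin N → ℝ) → ℝ≥0∞}
    (hf : Measurable f) :
    ∫⁻ a, f (spec (M + Matrix.vecMulVec (star a) a)) ∂rowLaw N t =
      ∫⁻ y, ENNReal.ofReal ((t⁻¹ : ℝ) ^ N) * weight t y * (weight t (spec M))⁻¹ *
        {y | WeakInterlace (spec M) y}.indicator 1 y * f y := by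
  obtain ⟨U, hU, hUM⟩ := exists_unitary_charpoly_add_star hM
  rw [← spec_eq hM] at hUM
  set x := spec M with hxdef
  let D : (Fin N → ℂ) → Matrix (Fin N) (Fin N) ℂ := fun a =>
    Matrix.diagonal (Complex.ofReal ∘ x) + Matrix.vecMulVec a (star a)
  have hD : ∀ a, (D a).IsHermitian := fun a =>
    (isHermitian_diagonal_ofReal x).add (isHermitian_vecMulVec_star a)
  have hspec : ∀ a : Fin N → ℂ, spec (M + Matrix.vecMulVec (star a) a) = spec (D (U *ᵥ a)) := by
    intro a
    refine spec_congr (hM.add ?_) (hD _) (hUM a)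
    simpa using isHermitian_vecMulVec_star (star a)
  have hDm : Measurable fun a => f (spec (D a)) :=
    hf.comp (measurable_spec (continuous_const.add (continuous_vecMulVec_star continuous_id)) hD)
  -- The vector of square roots represents all vectors with squared moduli `r`.
  let h : (Fin N → ℝ) → ℝ≥0∞ := fun r => f (spec (D fun i => ((√(r i) : ℝ) : ℂ)))
  have hsqrt : Continuous fun (r : Fin N → ℝ) (i : Fin N) => ((√(r i) : ℝ) : ℂ) := by fun_prop
  have hm : Measurable h := hDm.comp hsqrt.measurable
  have hDh : ∀ a : Fin N → ℂ, f (spec (D a)) = h fun i => Complex.normSq (a i) := by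
    intro a
    refine congrArg f (spec_diagonal_add_congr x fun i => ?_)
    rw [Complex.normSq_ofReal, Real.mul_self_sqrt (Complex.normSq_nonneg _)]
  have hUm : Measurable fun a : Fin N → ℂ => U *ᵥ a := by
    unfold Matrix.mulVec dotProduct
    fun_prop
  simp only [hspec]
  rw [← lintegral_map (f := fun a => f (spec (D a))) hDm hUm, rowLaw_map_unitary t hU]
  simp only [hDh]
  rw [lintegral_rowLaw_normSq ht hm, lintegral_pos_eq_strictInterlace hx,
    ← lintegral_indicator (measurableSet_strictInterlace x)]
  refine lintegral_congr_ae ?_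
  filter_upwards [weakInterlace_ae_iff (x := x)] with y hy
  by_cases hyx : y ∈ strictInterlace x
  · have hw : y ∈ {y | WeakInterlace x y} := hy.1 hyx
    rw [Set.indicator_of_mem hyx, Set.indicator_of_mem hw, Pi.one_apply, mul_one]
    have hh : h (residues x y) = f y := by
      refine congrArg f ?_
      rw [spec_eq (hD _)]
      refine orderedEigenvalues_diagonal_add hx hyx (fun i => ?_) _
      rw [Complex.normSq_ofReal, Real.mul_self_sqrt (residues_pos hx hyx i).le]
    rw [hh, ← mul_assoc]
    congr 1
    have hx0 := absVandermonde_pos hx.injective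
    have hy0 := absVandermonde_pos (strictInterlace.strictMono hx hyx).injective
    rw [weight, weight, ← ENNReal.ofReal_inv_of_pos (by positivity),
      ← ENNReal.ofReal_mul (by positivity), ← ENNReal.ofReal_mul (by positivity),
      ← ENNReal.ofReal_mul (by positivity), sum_residues hx.injective]
    congr 1
    have he : exp (-(∑ i, y i - ∑ i, x i) / t) =
        exp (-(∑ i, y i) / t) * (exp (-(∑ i, x i) / t))⁻¹ := by
      rw [← Real.exp_neg, ← Real.exp_add]
      congr 1
      ring
    rw [he, mul_inv]
    ring
  · rw [Set.indicator_of_notMem hyx, Set.indicator_of_notMem (s := {y | WeakInterlace x y})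
      fun h => hyx (hy.2 h)]
    simp

end LaguerreField

end

noncomputable section

namespace LaguerreField

open Function

variable {N : ℕ}

/-! ### Independent Gaussian rows -/

/-- Redrawing one coordinate independently preserves a product measure; finite-dimensional boxes
determine the law. -/
lemma infinitePi_map_update {ι : Type*} [DecidableEq ι] {X : ι → Type*}
    [∀ i, MeasurableSpace (X i)] (μ : ∀ i, Measure (X i)) [∀ i, IsProbabilityMeasure (μ i)]
    (n : ι) :
    ((Measure.infinitePi μ).prod (μ n)).map (fun p => update p.1 n p.2) =
      Measure.infinitePi μ := by
  refine Measure.eq_infinitePi _ fun s t ht => ?_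
  have hm : Measurable fun p : (∀ i, X i) × X n => update p.1 n p.2 := measurable_update'
  rw [Measure.map_apply hm (.pi s.countable_toSet fun _ _ => ht _)]
  by_cases hn : n ∈ s
  · have : (fun p : (∀ i, X i) × X n => update p.1 n p.2) ⁻¹' Set.pi s t =
        Set.pi (s.erase n) t ×ˢ t n := by
      ext p
      simp only [Set.mem_preimage, Set.mem_pi, Set.mem_prod, Finset.mem_coe, Finset.mem_erase]
      constructor
      · refine fun h => ⟨fun i hi => ?_, by simpa using h n hn⟩
        simpa [hi.1] using h i hi.2
      · rintro ⟨h1, h2⟩ i hi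
        rcases eq_or_ne i n with rfl | hin
        · simpa using h2
        · simpa [hin] using h1 i ⟨hin, hi⟩
    rw [this, Measure.prod_prod, Measure.infinitePi_pi _ fun i _ => ht i,
      Finset.prod_erase_mul _ _ hn]
  · have : (fun p : (∀ i, X i) × X n => update p.1 n p.2) ⁻¹' Set.pi s t =
        Set.pi s t ×ˢ Set.univ := by
      ext p
      simp only [Set.mem_preimage, Set.mem_pi, Set.mem_prod, Finset.mem_coe, Set.mem_univ,
        and_true]
      refine forall₂_congr fun i hi => ?_
      rw [update_of_ne (ne_of_mem_of_not_mem hi hn)]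
    rw [this, Measure.prod_prod, Measure.infinitePi_pi _ fun i _ => ht i, measure_univ, mul_one]

/-- Currying groups the real coordinates into pairs, and then the resulting complex entries into
rows. -/
lemma infinitePi_map_toComplex (N : ℕ) (t : ℝ≥0) :
    (Measure.infinitePi fun _ : (ℕ × Fin N) × Fin 2 => gaussianReal 0 t).map
      (fun x i j => toComplex (x ((i, j), 0), x ((i, j), 1))) =
      Measure.infinitePi fun _ : ℕ => rowLaw N t := by
  have hpair : (Measure.infinitePi fun _ : Fin 2 => gaussianReal 0 t).map
      (fun u => toComplex (u 0, u 1)) = complexGaussian t := by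
    rw [complexGaussian, Measure.infinitePi_eq_pi,
      ← (measurePreserving_finTwoArrow (gaussianReal 0 t)).map_eq,
      Measure.map_map measurable_toComplex (by fun_prop)]
    rfl
  have hf : Measurable fun u : Fin 2 → ℝ => toComplex (u 0, u 1) :=
    measurable_toComplex.comp (by fun_prop)
  have h1 := Measure.infinitePi_map_curry
    (fun (_ : ℕ × Fin N) (_ : Fin 2) => gaussianReal 0 t)
  have h2 := Measure.infinitePi_map_pi
    (fun _ : ℕ × Fin N => Measure.infinitePi fun _ : Fin 2 => gaussianReal 0 t)
    (f := fun _ u => toComplex (u 0, u 1)) fun _ => hf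
  have h3 := Measure.infinitePi_map_curry (fun (_ : ℕ) (_ : Fin N) => complexGaussian t)
  simp only [hpair] at h2
  simp only [Measure.infinitePi_eq_pi (fun _ : Fin N => complexGaussian t)] at h3
  have hg : Measurable fun (x : ℕ × Fin N → Fin 2 → ℝ) i => toComplex (x i 0, x i 1) :=
    measurable_pi_lambda _ fun i => hf.comp (measurable_pi_apply i)
  rw [← h2, ← h1, Measure.map_map hg (MeasurableEquiv.measurable _),
    Measure.map_map (MeasurableEquiv.measurable _)
      (hg.comp (MeasurableEquiv.measurable _))] at h3
  exact h3

/-! ### Rows of the Brownian array at a fixed time -/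

section Array

variable {Ω : Type*} [MeasurableSpace Ω] {P : Measure Ω} {b bt : ℕ → ℕ → ℝ≥0 → Ω → ℝ}

lemma IsBrownianArray.hasLaw_entries (hB : IsBrownianArray b bt P) (t : ℝ≥0) {κ : Type*}
    [Countable κ] {e : κ → (ℕ × ℕ) ⊕ (ℕ × ℕ)} (he : Injective e) :
    HasLaw (fun ω q => Sum.elim (fun p => b p.1 p.2 t ω) (fun p => bt p.1 p.2 t ω) (e q))
      (Measure.infinitePi fun _ : κ => gaussianReal 0 t) P := by
  have hlaw : ∀ q : (ℕ × ℕ) ⊕ (ℕ × ℕ), HasLaw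
      (fun ω => Sum.elim (fun p => b p.1 p.2 t ω) (fun p => bt p.1 p.2 t ω) q)
      (gaussianReal 0 t) P := by
    rintro (p | p)
    · exact (hB.brownian_re p.1 p.2).toIsPreBrownianReal.hasLaw_eval t
    · exact (hB.brownian_im p.1 p.2).toIsPreBrownianReal.hasLaw_eval t
  refine iIndepFun.hasLaw_infinitePi (fun q => hlaw (e q)) ?_
    (aemeasurable_pi_iff.2 fun q => (hlaw (e q)).aemeasurable)
  exact (hB.indep.precomp he).comp (fun _ x => x t) fun _ => measurable_pi_apply t

/-- The `i`-th row of the array of complex Brownian motions at time `t`. -/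
def row (N : ℕ) (b bt : ℕ → ℕ → ℝ≥0 → Ω → ℝ) (t : ℝ≥0) (ω : Ω) (i : ℕ) : Fin N → ℂ :=
  fun j => complexBM b bt i j t ω

lemma IsBrownianArray.hasLaw_row (hB : IsBrownianArray b bt P) (t : ℝ≥0) :
    HasLaw (row N b bt t) (Measure.infinitePi fun _ : ℕ => rowLaw N t) P := by
  let e : (ℕ × Fin N) × Fin 2 → (ℕ × ℕ) ⊕ (ℕ × ℕ) := fun q =>
    if q.2 = 0 then Sum.inl (q.1.1, q.1.2) else Sum.inr (q.1.1, q.1.2)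
  have he : Injective e := by
    rintro ⟨⟨i, j⟩, s⟩ ⟨⟨i', j'⟩, s'⟩ h
    fin_cases s <;> fin_cases s' <;> simp [e, Fin.val_inj] at h ⊢ <;> exact h
  have h := hB.hasLaw_entries t he
  have hm : Measurable fun (x : (ℕ × Fin N) × Fin 2 → ℝ) (i : ℕ) (j : Fin N) =>
      toComplex (x ((i, j), 0), x ((i, j), 1)) :=
    measurable_pi_lambda _ fun i => measurable_pi_lambda _ fun j =>
      measurable_toComplex.comp (by fun_prop)
  rw [← infinitePi_map_toComplex]
  exact HasLaw.comp ⟨hm.aemeasurable, rfl⟩ h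

/-- Allows the row `n` to be averaged while all other rows stay frozen. -/
lemma IsBrownianArray.lintegral_update_row (hB : IsBrownianArray b bt P) (t : ℝ≥0) (n : ℕ)
    {Ψ : (ℕ → Fin N → ℂ) → ℝ≥0∞} (hΨ : Measurable Ψ) :
    ∫⁻ ω, Ψ (row N b bt t ω) ∂P =
      ∫⁻ ω, ∫⁻ a, Ψ (update (row N b bt t ω) n a) ∂rowLaw N t ∂P := by
  have h := hB.hasLaw_row (N := N) t
  have hu : Measurable fun p : (ℕ → Fin N → ℂ) × (Fin N → ℂ) => update p.1 n p.2 :=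
    measurable_update'
  have hin : Measurable fun R => ∫⁻ a, Ψ (update R n a) ∂rowLaw N t :=
    (hΨ.comp hu).lintegral_prod_right'
  rw [← lintegral_map' (f := Ψ) hΨ.aemeasurable h.aemeasurable,
    ← lintegral_map' (f := fun R => ∫⁻ a, Ψ (update R n a) ∂rowLaw N t) hin.aemeasurable
      h.aemeasurable, h.map_eq]
  conv_lhs => rw [← infinitePi_map_update (fun _ : ℕ => rowLaw N t) n]
  rw [lintegral_map hΨ hu, lintegral_prod (fun p => Ψ (update p.1 n p.2)) (hΨ.comp hu).aemeasurable]

end Array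

end LaguerreField

end

noncomputable section

namespace LaguerreField

open Function

open scoped ComplexOrder

variable {N : ℕ}

/-! ### Zero sets of polynomials -/

/-- Fubini and induction: for almost all values of the other variables the leading coefficient in
the first one is nonzero, and the remaining polynomial has finitely many roots, a null set for an
atomless measure. -/
lemma ae_eval_ne_zero_fin (μ : Measure ℝ) [SigmaFinite μ] [NullSingletonClass μ] {n : ℕ}
    {p : MvPolynomial (Fin n) ℂ} (hp : p ≠ 0) :
    ∀ᵐ x ∂Measure.pi fun _ : Fin n => μ, MvPolynomial.eval (fun i => (x i : ℂ)) p ≠ 0 := by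
  induction n with
  | zero =>
    refine .of_forall fun x h => hp ?_
    rw [MvPolynomial.eq_C_of_isEmpty p, MvPolynomial.eval_C] at h
    rw [MvPolynomial.eq_C_of_isEmpty p, h, map_zero]
  | succ n ih =>
    have hc : ∀ {m : ℕ} (q : MvPolynomial (Fin m) ℂ),
        Measurable fun x : Fin m → ℝ => MvPolynomial.eval (fun i => (x i : ℂ)) q := fun q =>
      ((MvPolynomial.continuous_eval q).comp (by fun_prop)).measurable
    let e := (MeasurableEquiv.piFinSuccAbove (fun _ : Fin (n + 1) => ℝ) 0).symm
    have he : ∀ z, e z = Fin.cons z.1 z.2 := fun z => by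
      simp [e, MeasurableEquiv.piFinSuccAbove, Fin.consEquiv]
    have hmeas : MeasurableSet {x : Fin (n + 1) → ℝ |
        MvPolynomial.eval (fun i => (x i : ℂ)) p ≠ 0} := hc p (measurableSet_singleton 0).compl
    have hmeas' : MeasurableSet {z : ℝ × (Fin n → ℝ) |
        MvPolynomial.eval (fun i => (e z i : ℂ)) p ≠ 0} := e.measurable hmeas
    rw [← (measurePreserving_piFinSuccAbove (fun _ : Fin (n + 1) => μ) 0).symm.map_eq,
      ae_map_iff e.measurable.aemeasurable hmeas, Measure.ae_prod_iff_ae_ae (p := fun z => MvPolynomial.eval (fun i => (e z i : ℂ)) p ≠ 0)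
        hmeas',
      Measure.ae_ae_comm (p := fun x y => MvPolynomial.eval (fun i => (e (x, y) i : ℂ)) p ≠ 0)
        hmeas']
    let q := MvPolynomial.finSuccEquiv ℂ n p
    have hq : q ≠ 0 := by simpa [q] using hp
    filter_upwards [ih (Polynomial.leadingCoeff_ne_zero.2 hq)] with y hy
    let r := q.map (MvPolynomial.eval fun i => (y i : ℂ))
    have hr : r ≠ 0 := fun h => hy (by
      have := congrArg (fun s => s.coeff q.natDegree) h
      simpa [r, Polynomial.coeff_map] using this)
    have hfin : {s : ℝ | r.eval (s : ℂ) = 0}.Finite := by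
      refine Set.Finite.preimage Complex.ofReal_injective.injOn (s := {z : ℂ | r.eval z = 0}) ?_
      exact Polynomial.finite_setOfPred_isRoot hr
    have hnull : ∀ᵐ s ∂μ, s ∉ {s : ℝ | r.eval (s : ℂ) = 0} := by
      rw [ae_iff]
      simpa using hfin.measure_zero μ
    filter_upwards [hnull] with s hs h
    refine hs ?_
    rw [← MvPolynomial.eval_eq_eval_mv_eval', ← h]
    refine congrArg (fun v => MvPolynomial.eval v p) (funext fun i => ?_)
    rw [he]
    refine Fin.cases ?_ (fun i => ?_) i <;> simp

lemma ae_eval_ne_zero (μ : Measure ℝ) [SigmaFinite μ] [NullSingletonClass μ] {κ : Type*} [Fintype κ]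
    {p : MvPolynomial κ ℂ} (hp : p ≠ 0) :
    ∀ᵐ x ∂Measure.pi fun _ : κ => μ, MvPolynomial.eval (fun i => (x i : ℂ)) p ≠ 0 := by
  let e := Fintype.equivFin κ
  have h := ae_eval_ne_zero_fin μ (p := MvPolynomial.rename e p)
    fun h => hp (MvPolynomial.rename_injective e e.injective (by rw [h, map_zero]))
  rw [← (measurePreserving_piCongrLeft (fun _ => μ) e).map_eq] at h
  filter_upwards [ae_of_ae_map (MeasurableEquiv.measurable _).aemeasurable h] with x hx hx0
  refine hx ?_
  have : (fun i => (MeasurableEquiv.piCongrLeft (fun _ => ℝ) e x i : ℂ)) ∘ e =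
      fun i => (x i : ℂ) := by
    ext i
    exact congrArg Complex.ofReal (Equiv.piCongrLeft_apply_apply (fun _ => ℝ) e x i)
  rw [MvPolynomial.eval_rename, this, hx0]

/-! ### Simplicity of the spectrum -/

/-- A polynomial in the entries of a matrix, whose nonvanishing means that the eigenvalues are
distinct and nonzero. -/
def simplicity {R : Type*} [CommRing R] (M : Matrix (Fin N) (Fin N) R) : R :=
  (Matrix.of fun i j : Fin N => (M ^ (i + j : ℕ)).trace).det * M.det

lemma map_simplicity {R S : Type*} [CommRing R] [CommRing S] (φ : R →+* S)
    (M : Matrix (Fin N) (Fin N) R) : φ (simplicity M) = simplicity (φ.mapMatrix M) := by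
  rw [simplicity, simplicity, map_mul, RingHom.map_det, RingHom.map_det]
  congr 2
  ext i j
  rw [RingHom.mapMatrix_apply, Matrix.of_apply, Matrix.map_apply, Matrix.of_apply, ← map_pow]
  simp [AddMonoidHom.map_trace]

/-- The Hankel matrix of power sums is `Vᵀ V` for the Vandermonde matrix `V`, so its determinant is
the discriminant. -/
lemma simplicity_diagonal {R : Type*} [CommRing R] (d : Fin N → R) :
    simplicity (Matrix.diagonal d) = (Matrix.vandermonde d).det ^ 2 * ∏ i, d i := by
  have : (Matrix.of fun i j : Fin N => (Matrix.diagonal d ^ (i + j : ℕ)).trace) =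
      (Matrix.vandermonde d)ᵀ * Matrix.vandermonde d := by
    ext i j
    rw [Matrix.vandermonde_transpose_mul_vandermonde, Matrix.of_apply, Matrix.diagonal_pow,
      Matrix.trace_diagonal]
    rfl
  rw [simplicity, this, Matrix.det_mul, Matrix.det_transpose, Matrix.det_diagonal, sq]

/-- Traces of powers and the determinant are invariant under unitary conjugation. -/
lemma simplicity_eq {M : Matrix (Fin N) (Fin N) ℂ} (hM : M.IsHermitian) :
    simplicity M = simplicity (Matrix.diagonal (Complex.ofReal ∘ hM.eigenvalues)) := by
  set D := Matrix.diagonal (Complex.ofReal ∘ hM.eigenvalues) with hD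
  have h : M = Unitary.conjStarAlgAut ℂ _ hM.eigenvectorUnitary D := hM.spectral_theorem
  have hU := Unitary.coe_star_mul_self hM.eigenvectorUnitary
  have htr : ∀ X, (Unitary.conjStarAlgAut ℂ _ hM.eigenvectorUnitary X).trace = X.trace := by
    intro X
    rw [Unitary.conjStarAlgAut_apply, Matrix.trace_mul_cycle, hU, one_mul]
  have hdet : ∀ X, (Unitary.conjStarAlgAut ℂ _ hM.eigenvectorUnitary X).det = X.det := by
    intro X
    rw [Unitary.conjStarAlgAut_apply, Matrix.det_mul_comm, ← mul_assoc, hU, one_mul]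
  rw [simplicity, simplicity]
  congr 1
  · congr 1
    ext i j
    rw [Matrix.of_apply, Matrix.of_apply]
    conv_lhs => rw [h, ← map_pow, htr]
  · conv_lhs => rw [h, hdet]

lemma spec_mem_weylPos {M : Matrix (Fin N) (Fin N) ℂ} (hM : M.PosSemidef)
    (h : simplicity M ≠ 0) : spec M ∈ weylPos N := by
  rw [simplicity_eq hM.1, simplicity_diagonal] at h
  have hinj : Injective hM.1.eigenvalues := by
    have := Matrix.det_vandermonde_ne_zero_iff.1 (pow_ne_zero_iff two_ne_zero |>.1
      (left_ne_zero_of_mul h))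
    exact Injective.of_comp this
  have hne : ∀ i, hM.1.eigenvalues i ≠ 0 := fun i hi =>
    right_ne_zero_of_mul h (Finset.prod_eq_zero (Finset.mem_univ i) (by simp [hi]))
  have hpos : ∀ i, 0 < hM.1.eigenvalues i := fun i =>
    (hM.eigenvalues_nonneg i).lt_of_ne (hne i).symm
  obtain ⟨σ, hσ⟩ : ∃ σ : Fin N → Fin N, Injective σ ∧
      ∀ i, orderedEigenvalues hM.1 i = hM.1.eigenvalues (σ i) := by
    let e : Fin (Fintype.card (Fin N)) ≃ Fin N :=
      Fintype.equivOfCardEq (Fintype.card_fin _)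
    refine ⟨fun j => e (Fin.cast (Fintype.card_fin N).symm (Fin.rev j)), fun i j hij => ?_,
      fun i => ?_⟩
    · simpa using hij
    · simp [orderedEigenvalues, Matrix.IsHermitian.eigenvalues, e]
  rw [spec_eq hM.1]
  refine ⟨(orderedEigenvalues_monotone _).strictMono_of_injective fun i j hij => ?_, fun i => ?_⟩
  · rw [hσ.2, hσ.2] at hij
    exact hσ.1 (hinj hij)
  · rw [hσ.2]
    exact hpos _

/-- The square matrix with entries `toComplex` of the given real and imaginary parts. -/
def complexMatrix (x : (Fin N × Fin N) × Fin 2 → ℝ) : Matrix (Fin N) (Fin N) ℂ :=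
  Matrix.of fun i j => toComplex (x ((i, j), 0), x ((i, j), 1))

lemma ae_simplicity_ne_zero (μ : Measure ℝ) [SigmaFinite μ] [NullSingletonClass μ] :
    ∀ᵐ x ∂Measure.pi fun _ : (Fin N × Fin N) × Fin 2 => μ,
      simplicity ((complexMatrix x)ᴴ * complexMatrix x) ≠ 0 := by
  -- Conjugation is not polynomial. At real points, however, the adjoint is the transpose with `i`
  -- replaced by `-i`, hence the parameter `u`.
  let A : ℂ → Matrix (Fin N) (Fin N) (MvPolynomial ((Fin N × Fin N) × Fin 2) ℂ) := fun u =>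
    Matrix.of fun i j => MvPolynomial.C ((√2 : ℝ) : ℂ)⁻¹ *
      (MvPolynomial.X ((i, j), 0) + MvPolynomial.C u * MvPolynomial.X ((i, j), 1))
  let p := simplicity ((A (-Complex.I))ᵀ * A Complex.I)
  have heval : ∀ x : (Fin N × Fin N) × Fin 2 → ℝ, MvPolynomial.eval (fun i => (x i : ℂ)) p =
      simplicity ((complexMatrix x)ᴴ * complexMatrix x) := by
    intro x
    rw [map_simplicity, map_mul]
    congr 2
    · ext i j
      simp [A, complexMatrix, toComplex]
      ring
    · ext i j
      simp [A, complexMatrix, toComplex]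
      ring
  have hp : p ≠ 0 := by
    intro hp0
    -- The witness is `diag(1, …, N)`, with `√2` undoing the normalization of `toComplex`; its Gram
    -- matrix has the distinct nonzero eigenvalues `1, 4, …, N²`.
    let x : (Fin N × Fin N) × Fin 2 → ℝ := fun q =>
      if q.1.1 = q.1.2 ∧ q.2 = 0 then √2 * (q.1.1 + 1 : ℕ) else 0
    have hx : complexMatrix x = Matrix.diagonal fun i : Fin N => ((i + 1 : ℕ) : ℂ) := by
      ext i j
      rcases eq_or_ne i j with rfl | hij
      · simp [complexMatrix, toComplex, x]
      · simp [complexMatrix, toComplex, x, hij]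
    have h := heval x
    rw [hp0, map_zero, hx, Matrix.diagonal_conjTranspose, Matrix.diagonal_mul_diagonal,
      simplicity_diagonal, eq_comm, mul_eq_zero, Finset.prod_eq_zero_iff] at h
    rcases h with h | ⟨i, -, h⟩
    · refine Matrix.det_vandermonde_ne_zero_iff.2 ?_ (pow_eq_zero_iff two_ne_zero |>.1 h)
      intro i j hij
      have h1 : (((i + 1) * (i + 1) : ℕ) : ℂ) = ((j + 1) * (j + 1) : ℕ) := by simpa using hij
      have h2 := Nat.mul_self_inj.1 (Nat.cast_injective h1)
      exact Fin.ext (Nat.succ_injective h2)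
    · have h1 : (((i + 1) * (i + 1) : ℕ) : ℂ) = 0 := by simpa using h
      exact absurd (Nat.cast_eq_zero.1 h1) (by positivity)
  filter_upwards [ae_eval_ne_zero μ hp] with x hx
  rwa [← heval]

end LaguerreField

end

noncomputable section

namespace LaguerreField

open Function

open scoped ComplexOrder

variable {N : ℕ}

/-! ### The Laguerre field as an interlacing chain -/

/-- The Gram matrix `Aᴴ * A` of the matrix `A` whose rows are `R 0, …, R (n - 1)`. -/
def gram (n : ℕ) (R : ℕ → Fin N → ℂ) : Matrix (Fin N) (Fin N) ℂ :=
  ∑ i ∈ Finset.range n, Matrix.vecMulVec (star (R i)) (R i)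

lemma gram_eq_mul (n : ℕ) (R : ℕ → Fin N → ℂ) :
    gram n R = (Matrix.of fun (i : Fin n) j => R i j)ᴴ * Matrix.of fun (i : Fin n) j => R i j := by
  ext i j
  rw [gram, Matrix.sum_apply, Finset.sum_range, Matrix.mul_apply]
  rfl

lemma posSemidef_gram (n : ℕ) (R : ℕ → Fin N → ℂ) : (gram n R).PosSemidef := by
  rw [gram_eq_mul]
  exact Matrix.posSemidef_conjTranspose_mul_self _

lemma continuous_gram (n : ℕ) : Continuous (gram (N := N) n) := by
  refine continuous_matrix fun i j => ?_
  simp only [gram, Matrix.sum_apply, Matrix.vecMulVec_apply, Pi.star_apply]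
  fun_prop

lemma gram_congr {n : ℕ} {R R' : ℕ → Fin N → ℂ} (h : ∀ i < n, R i = R' i) :
    gram n R = gram n R' :=
  Finset.sum_congr rfl fun i hi => by rw [h i (Finset.mem_range.1 hi)]

lemma gram_update_of_le {m n : ℕ} (h : m ≤ n) (R : ℕ → Fin N → ℂ) (a : Fin N → ℂ) :
    gram m (update R n a) = gram m R :=
  gram_congr fun _ hi => update_of_ne (hi.trans_le h).ne _ _

lemma gram_succ_update (n : ℕ) (R : ℕ → Fin N → ℂ) (a : Fin N → ℂ) :
    gram (n + 1) (update R n a) = gram n R + Matrix.vecMulVec (star a) a := by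
  rw [gram, Finset.sum_range_succ, update_self, ← gram, gram_update_of_le le_rfl]

lemma measurable_spec_gram (n : ℕ) :
    Measurable fun R : ℕ → Fin N → ℂ => spec (gram n R) :=
  measurable_spec (continuous_gram n) fun R => (posSemidef_gram n R).1

lemma measurableSet_weylPos : MeasurableSet (weylPos N) := by
  refine MeasurableSet.inter (s₁ := {x : Fin N → ℝ | StrictMono x})
    (s₂ := {x : Fin N → ℝ | ∀ i, 0 < x i}) (measurableSet_strictMono measurable_id) ?_
  rw [Set.ofPred_forall]
  exact MeasurableSet.iInter fun i => measurableSet_lt (by fun_prop) (by fun_prop)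

lemma field_eq_spec {Ω : Type*} (b bt : ℕ → ℕ → ℝ≥0 → Ω → ℝ) (t : ℝ≥0) (n : ℕ) (ω : Ω) :
    field b bt N n t ω = spec (gram (N + n) (row N b bt t ω)) := by
  have h : gram (N + n) (row N b bt t ω) = (matA b bt N n t ω)ᴴ * matA b bt N n t ω :=
    gram_eq_mul _ _
  rw [h, spec_eq (Matrix.isHermitian_conjTranspose_mul_self _)]
  rfl

/-! ### Transition step, strict ordering and positivity of the field -/

section Field

variable {Ω : Type*} [MeasurableSpace Ω] {P : Measure Ω} {b bt : ℕ → ℕ → ℝ≥0 → Ω → ℝ} {t : ℝ≥0}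

lemma IsBrownianArray.aemeasurable_field (hB : IsBrownianArray b bt P) (n : ℕ) :
    AEMeasurable (field b bt N n t) P := by
  have : field b bt N n t = fun ω => spec (gram (N + n) (row N b bt t ω)) :=
    funext (field_eq_spec b bt t n)
  rw [this]
  exact (measurable_spec_gram _).comp_aemeasurable (hB.hasLaw_row t).aemeasurable

/-- Levels up to `n` use only rows of index below `N + n`. Redrawing row `N + n` therefore affects
level `n + 1` alone among the levels that `F` sees. -/
lemma IsBrownianArray.lintegral_field_step (hB : IsBrownianArray b bt P) (ht : 0 < t) {n : ℕ}
    (hs : ∀ᵐ ω ∂P, StrictMono (field b bt N n t ω)) {F : (ℕ → Fin N → ℝ) → ℝ≥0∞}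
    (hF : Measurable F) (hd : DependsOn F (Set.Iic (n + 1))) :
    ∫⁻ ω, F (fun l => field b bt N l t ω) ∂P =
      ∫⁻ ω, (∫⁻ y, ENNReal.ofReal ((t⁻¹ : ℝ) ^ N) * weight t y *
        (weight t (field b bt N n t ω))⁻¹ *
        {y | WeakInterlace (field b bt N n t ω) y}.indicator 1 y *
        F (update (fun l => field b bt N l t ω) (n + 1) y)) ∂P := by
  simp only [field_eq_spec] at hs ⊢
  rw [hB.lintegral_update_row t (N + n) (Ψ := fun R => F fun l => spec (gram (N + l) R))
    (hF.comp (measurable_pi_lambda _ fun l => measurable_spec_gram _))]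
  refine lintegral_congr_ae ?_
  filter_upwards [hs] with ω hω
  refine Eq.trans ?_ (lintegral_spec_add_rowLaw ht (posSemidef_gram _ _).1 hω
    (hF.comp (measurable_update (fun l => spec (gram (N + l) (row N b bt t ω))))))
  refine lintegral_congr fun a => hd fun l hl => ?_
  rcases eq_or_lt_of_le (Set.mem_Iic.1 hl) with rfl | hl
  · rw [update_self, ← add_assoc, gram_succ_update]
  · rw [update_of_ne hl.ne, gram_update_of_le (by omega)]

lemma IsBrownianArray.field_zero_mem_weylPos (hB : IsBrownianArray b bt P) (ht : 0 < t) :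
    ∀ᵐ ω ∂P, field b bt N 0 t ω ∈ weylPos N := by
  let e : (Fin N × Fin N) × Fin 2 → (ℕ × ℕ) ⊕ (ℕ × ℕ) := fun q =>
    if q.2 = 0 then Sum.inl (q.1.1, q.1.2) else Sum.inr (q.1.1, q.1.2)
  have he : Injective e := by
    rintro ⟨⟨i, j⟩, s⟩ ⟨⟨i', j'⟩, s'⟩ h
    fin_cases s <;> fin_cases s' <;> simp [e, Fin.val_inj] at h ⊢ <;> exact h
  have h := hB.hasLaw_entries t he
  have := nullSingletonClass_gaussianReal (μ := 0) ht.ne'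
  have hae := ae_simplicity_ne_zero (N := N) (gaussianReal 0 t)
  rw [← Measure.infinitePi_eq_pi, ← h.map_eq] at hae
  filter_upwards [ae_of_ae_map h.aemeasurable hae] with ω hω
  rw [field_eq_spec]
  refine spec_mem_weylPos (posSemidef_gram _ _) ?_
  rw [gram_eq_mul]
  exact hω

/-- The step formula needs a strictly ordered start, so level `0` is treated separately. From then
on the next level has a density carried by vectors interlacing with the current one, and almost all
of these are strictly ordered and larger coordinatewise, hence positive. -/
lemma IsBrownianArray.field_mem_weylPos (hB : IsBrownianArray b bt P) (ht : 0 < t) (n : ℕ) :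
    ∀ᵐ ω ∂P, field b bt N n t ω ∈ weylPos N := by
  induction n with
  | zero => exact hB.field_zero_mem_weylPos ht
  | succ n ih =>
    let F : (ℕ → Fin N → ℝ) → ℝ≥0∞ := fun x => (weylPos N)ᶜ.indicator 1 (x (n + 1))
    have hF : Measurable F :=
      (measurable_one.indicator measurableSet_weylPos.compl).comp (measurable_pi_apply _)
    have hd : DependsOn F (Set.Iic (n + 1)) := fun x y h => by
      simp only [F, h (n + 1) Set.self_mem_Iic]
    have hstep := hB.lintegral_field_step ht (ih.mono fun ω h => h.1) hF hd
    have hzero : ∫⁻ ω, F (fun l => field b bt N l t ω) ∂P = 0 := by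
      rw [hstep, lintegral_congr_ae (g := fun _ => 0), lintegral_zero]
      filter_upwards [ih] with ω hω
      rw [lintegral_congr_ae (g := fun _ => 0), lintegral_zero]
      filter_upwards [weakInterlace_ae_iff (x := field b bt N n t ω)] with y hy
      by_cases hyx : y ∈ strictInterlace (field b bt N n t ω)
      · have hyw : y ∈ weylPos N := ⟨strictInterlace.strictMono hω.1 hyx, fun i =>
          (hω.2 i).trans (hyx.1 i)⟩
        simp [F, hyw]
      · rw [Set.indicator_of_notMem (s := {y | WeakInterlace (field b bt N n t ω) y})
          fun h => hyx (hy.2 h)]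
        simp
    have hm : AEMeasurable (fun ω => F fun l => field b bt N l t ω) P :=
      (measurable_one.indicator measurableSet_weylPos.compl).comp_aemeasurable
        (hB.aemeasurable_field (n + 1))
    rw [lintegral_eq_zero_iff' hm] at hzero
    filter_upwards [hzero] with ω hω
    by_contra hcon
    simp [F, hcon] at hω

lemma IsBrownianArray.isInterlacingChain (hB : IsBrownianArray b bt P) (ht : 0 < t) :
    IsInterlacingChain (fun n ω => field b bt N n t ω) P (ENNReal.ofReal ((t⁻¹ : ℝ) ^ N))
      (weight t) where
  aemeasurable := hB.aemeasurable_field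
  strictMono := ae_all_iff.2 fun n => (hB.field_mem_weylPos ht n).mono fun _ h => h.1
  measurable_weight := measurable_weight t
  weight_ne_top _ := ENNReal.ofReal_ne_top
  weight_ne_zero _ hx := weight_ne_zero t hx.injective
  weight_ae_ne_zero := ae_injective.mono fun _ hx => weight_ne_zero t hx
  lintegral_step n _ hF hd :=
    hB.lintegral_field_step ht ((hB.field_mem_weylPos ht n).mono fun _ h => h.1) hF hd

end Field

end LaguerreField

end

theorem lemma5p2 {Ω : Type*} [MeasurableSpace Ω] (P : Measure Ω) [IsProbabilityMeasure P]
    (b bt : ℕ → ℕ → ℝ≥0 → Ω → ℝ) (hB : LaguerreField.IsBrownianArray b bt P)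
    (N : ℕ) (hN : 1 ≤ N) (t₀ : ℝ≥0) (ht₀ : 0 < t₀) :
    LaguerreField.ExponentialGibbs (fun α ω => LaguerreField.field b bt N α t₀ ω) P :=
  (hB.isInterlacingChain ht₀).exponentialGibbs
    (ae_all_iff.2 fun n => (hB.field_mem_weylPos ht₀ n).mono fun _ h => h.2)
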